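/- Let $[k,k]=k_0^2-k_1^2-k_2^2$ on $\mathbb R^3$ and let $SO_0(2,1)$ be the identity component of the group of linear maps preserving $[k,k]$. Let $r(\theta)$ be the rotation in the plane $(k_1,k_2)$ sending $(1,\sin\phi,\cos\phi)$ to $(1,\sin(\phi+\theta),\cos(\phi+\theta))$, and $h(\alpha)$ the hyperbolic rotation $(k_0,k_1,k_2)\mapsto(k_0\cosh\alpha+k_2\sinh\alpha,\;k_1,\;k_0\sinh\alpha+k_2\cosh\alpha)$. For real $\sigma$ let $\mathcal F^\sigma$ be the space of smooth complex functions $f$ on the circle, identified with the homogeneous functions $F(k)=\omega^\sigma f(\phi)$, $k=\omega(1,\sin\phi,\cos\phi)$, $\omega>0$, of degree $\sigma$ on the cone $[k,k]=0$, $k_0>0$, and let $T_\sigma$ be the representation of $SO_0(2,1)$ in $\mathcal F^\sigma$ given by $T_\sigma(g)F(k)=F(g^{-1}k)$. Write $f_m=\frac1{2\pi}\int_0^{2\pi}f(\phi)e^{-im\phi}\,d\phi$. **Theorem 1 (complementary series).** (a) Every $g\in SO_0(2,1)$ has the form $r(\phi_1)h(\alpha)r(\phi_2)$, and $$T_\sigma(r(\theta))f(\phi)=f(\phi-\theta),\qquad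 T_\sigma(h(\alpha))f(\phi)=\omega_\alpha^{\sigma}f(\phi_\alpha),$$ where $\omega_\alpha=\cosh\alpha-\sinh\alpha\cos\phi>0$, $\sin\phi_\alpha=\sin\phi/\omega_\alpha$, $\cos\phi_\alpha=(-\sinh\alpha+\cosh\alpha\cos\phi)/\omega_\alpha$. (b) Let $-1<\sigma<0$ and $c_0>0$. Then the form $$(f^{(1)},f^{(2)})_\sigma=c_0\,\frac{2^{-\sigma-1}}{\sqrt\pi\,\Gamma(\sigma+1)}\sum_{m=-\infty}^{\infty}\Phi_m\,\overline{f^{(1)}_m}\,f^{(2)}_m,\qquad \Phi_m=\frac{\Gamma(m+\sigma+1)}{\Gamma(m-\sigma)},$$ is given by absolutely convergent series and is a scalar product (Hermitian and positive definite) on $\mathcal F^\sigma$ invariant under $T_\sigma$. The representation $T_\sigma$ is unitary and irreducible with respect to it: it extends to a strongly continuous unitary representation in the Hilbert space completion of $\mathcal F^\sigma$, which has no proper nonzero closed invariant subspace; moreover $\mathcal F^\sigma$ itself, with the topology of uniform convergence of all derivatives, has no proper nonzero closed $T_\sigma$-invariant subspace. (c) For real $c_0$ and $-1<\sigma<-1/2$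 this form is given by the absolutely convergent integral $$(f^{(1)},f^{(2)})_\sigma=\frac{c_0}{4\pi^2\,\Gamma(-\sigma-1/2)}\int_0^{2\pi}\!\!\int_0^{2\pi}\bigl[1-\cos(\phi_1-\phi_2)\bigr]^{-\sigma-1}\,\overline{f^{(1)}(\phi_1)}\,f^{(2)}(\phi_2)\,d\phi_1\,d\phi_2,$$ and for fixed $c_0,f^{(1)},f^{(2)}$ it is a real-analytic function of $\sigma\in(-1,0)$, so that for $-1/2\le\sigma<0$ it is the regularization of this integral by analytic continuation in $\sigma$. (d) Positivity holds exactly for $-1<\sigma<0$: for real non-integer $\sigma$ and real $c_0$, the form $(\cdot,\cdot)_\sigma$ is a scalar product if and only if $-1<\sigma<0$ and $c_0>0$; and for an integer $n$, no limit of the forms $(\cdot,\cdot)_s$ as $s\to n$, $s\ne n$, with any choice of real constants $c_0=c_0(s)$, is a scalar product. -/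

import Mathlib

open Set Filter Topology MeasureTheory
open scoped ContDiff Matrix ComplexConjugate

namespace SO21

/-- The quadratic form `[k, k] = k₀² - k₁² - k₂²`. -/
def quad (k : Fin 3 → ℝ) : ℝ := k 0 ^ 2 - k 1 ^ 2 - k 2 ^ 2

/-- The group `O(2,1)` of linear motions preserving `[k, k]`. -/
def O21 : Subgroup (GL (Fin 3) ℝ) where
  carrier := {g | ∀ k : Fin 3 → ℝ, quad ((g : Matrix (Fin 3) (Fin 3) ℝ) *ᵥ k) = quad k}
  one_mem' := by intro k; simp
  mul_mem' := by
    intro a b ha hb k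
    have h := ha ((b : Matrix (Fin 3) (Fin 3) ℝ) *ᵥ k)
    rw [hb k, Matrix.mulVec_mulVec] at h
    simpa using h
  inv_mem' := by
    intro a ha k
    have h := ha (((a⁻¹ : GL (Fin 3) ℝ) : Matrix (Fin 3) (Fin 3) ℝ) *ᵥ k)
    rw [Matrix.mulVec_mulVec, ← Units.val_mul, mul_inv_cancel] at h
    simpa using h.symm

/-- `SO₀(2,1)`: the connected component of the identity in `O(2,1)`, with the subspace topology. -/
abbrev G : Type := ↥(Subgroup.connectedComponentOfOne ↥O21)

/-- The `3 × 3` matrix of an element of `SO₀(2,1)`. -/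
def mat (g : G) : Matrix (Fin 3) (Fin 3) ℝ := ((g : ↥O21) : GL (Fin 3) ℝ)

theorem mat_one : mat 1 = 1 := rfl

theorem mat_mul (g h : G) : mat (g * h) = mat g * mat h := rfl

theorem quad_mat (g : G) (k : Fin 3 → ℝ) : quad (mat g *ᵥ k) = quad k := (g : ↥O21).2 k

theorem mat_inv_mulVec (g : G) (k : Fin 3 → ℝ) : mat g⁻¹ *ᵥ (mat g *ᵥ k) = k := by
  rw [Matrix.mulVec_mulVec, ← mat_mul, inv_mul_cancel, mat_one, Matrix.one_mulVec]

theorem continuous_mat : Continuous mat :=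
  Units.continuous_val.comp (continuous_subtype_val.comp continuous_subtype_val)

/-- A continuous one-parameter family in `O(2,1)` through the identity lies in `SO₀(2,1)`. -/
theorem mem_component (p : ℝ → ↥O21) (hp : Continuous p) (h0 : p 0 = 1) (t : ℝ) :
    p t ∈ Subgroup.connectedComponentOfOne ↥O21 := by
  change p t ∈ connectedComponent (1 : ↥O21)
  have h := (isPreconnected_range hp).subset_connectedComponent ⟨0, h0⟩
  exact h ⟨t, rfl⟩

/-- Matrix of the rotation by the angle `θ` in the plane `(k₁, k₂)`. -/
noncomputable def rotMat (θ : ℝ) : Matrix (Fin 3) (Fin 3) ℝ :=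
  !![1, 0, 0; 0, Real.cos θ, Real.sin θ; 0, -Real.sin θ, Real.cos θ]

/-- Matrix of the hyperbolic rotation by `α` in the plane `(k₀, k₂)`. -/
noncomputable def boostMat (α : ℝ) : Matrix (Fin 3) (Fin 3) ℝ :=
  !![Real.cosh α, 0, Real.sinh α; 0, 1, 0; Real.sinh α, 0, Real.cosh α]

theorem rotMat_mul_neg (θ : ℝ) : rotMat θ * rotMat (-θ) = 1 := by
  have h := Real.sin_sq_add_cos_sq θ
  ext i j
  fin_cases i <;> fin_cases j <;>
    simp [rotMat, Matrix.mul_apply, Fin.sum_univ_three] <;> nlinarith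

theorem boostMat_mul_neg (α : ℝ) : boostMat α * boostMat (-α) = 1 := by
  have h := Real.cosh_sq α
  ext i j
  fin_cases i <;> fin_cases j <;>
    simp [boostMat, Matrix.mul_apply, Fin.sum_univ_three] <;> nlinarith

theorem continuous_rotMat : Continuous rotMat := by
  refine continuous_matrix fun i j => ?_
  fin_cases i <;> fin_cases j <;> simp [rotMat] <;> fun_prop

theorem continuous_boostMat : Continuous boostMat := by
  refine continuous_matrix fun i j => ?_
  fin_cases i <;> fin_cases j <;> simp [boostMat] <;> fun_prop

theorem quad_rotMat (θ : ℝ) (k : Fin 3 → ℝ) : quad (rotMat θ *ᵥ k) = quad k := by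
  have h := Real.sin_sq_add_cos_sq θ
  simp [quad, rotMat, Matrix.mulVec, dotProduct, Fin.sum_univ_three]
  linear_combination (-(k 1) ^ 2 - (k 2) ^ 2) * h

theorem quad_boostMat (α : ℝ) (k : Fin 3 → ℝ) : quad (boostMat α *ᵥ k) = quad k := by
  have h := Real.cosh_sq α
  simp [quad, boostMat, Matrix.mulVec, dotProduct, Fin.sum_univ_three]
  linear_combination ((k 0) ^ 2 - (k 2) ^ 2) * h

noncomputable def rotO (θ : ℝ) : ↥O21 :=
  ⟨⟨rotMat θ, rotMat (-θ), rotMat_mul_neg θ, by simpa using rotMat_mul_neg (-θ)⟩, quad_rotMat θ⟩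

noncomputable def boostO (α : ℝ) : ↥O21 :=
  ⟨⟨boostMat α, boostMat (-α), boostMat_mul_neg α, by simpa using boostMat_mul_neg (-α)⟩,
    quad_boostMat α⟩

theorem continuous_rotO : Continuous rotO := by
  refine Continuous.subtype_mk (Units.continuous_iff.2 ⟨?_, ?_⟩) _
  · exact continuous_rotMat
  · exact continuous_rotMat.comp continuous_neg

theorem continuous_boostO : Continuous boostO := by
  refine Continuous.subtype_mk (Units.continuous_iff.2 ⟨?_, ?_⟩) _
  · exact continuous_boostMat
  · exact continuous_boostMat.comp continuous_neg

theorem rotO_zero : rotO 0 = 1 := by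
  apply Subtype.ext
  apply Units.ext
  change rotMat 0 = 1
  ext i j
  fin_cases i <;> fin_cases j <;> simp [rotMat]

theorem boostO_zero : boostO 0 = 1 := by
  apply Subtype.ext
  apply Units.ext
  change boostMat 0 = 1
  ext i j
  fin_cases i <;> fin_cases j <;> simp [boostMat]

/-- The rotation `r(θ)` in the plane `(k₁, k₂)`, as an element of `SO₀(2,1)`. -/
noncomputable def rot (θ : ℝ) : G := ⟨rotO θ, mem_component rotO continuous_rotO rotO_zero θ⟩

/-- The hyperbolic rotation `h(α)` in the plane `(k₀, k₂)`, as an element of `SO₀(2,1)`. -/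
noncomputable def boost (α : ℝ) : G :=
  ⟨boostO α, mem_component boostO continuous_boostO boostO_zero α⟩

/-- The point `(1, sin φ, cos φ)` of the upper cone `[k, k] = 0`, `k₀ > 0`. -/
noncomputable def conePoint (φ : ℝ) : Fin 3 → ℝ := ![1, Real.sin φ, Real.cos φ]

/-- The angular coordinate: `k = k₀ (1, sin φ, cos φ)` with `φ = angle k` on the upper cone. -/
noncomputable def angle (k : Fin 3 → ℝ) : ℝ := Complex.arg ⟨k 2, k 1⟩

theorem eq_smul_conePoint {k : Fin 3 → ℝ} (h : quad k = 0) (h0 : 0 < k 0) :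
    k = k 0 • conePoint (angle k) := by
  have hn : ‖(⟨k 2, k 1⟩ : ℂ)‖ = k 0 := by
    rw [Complex.norm_def, Complex.normSq_mk, Real.sqrt_eq_iff_mul_self_eq_of_pos h0]
    unfold quad at h
    linarith
  have hz : (⟨k 2, k 1⟩ : ℂ) ≠ 0 := by
    intro h'
    rw [h', norm_zero] at hn
    exact h0.ne hn
  have hs : k 0 * Real.sin (angle k) = k 1 := by
    rw [angle, Complex.sin_arg, hn]
    field_simp
  have hc : k 0 * Real.cos (angle k) = k 2 := by
    rw [angle, Complex.cos_arg hz, hn]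
    field_simp
  ext i
  fin_cases i
  · simp [conePoint]
  · simpa [conePoint] using hs.symm
  · simpa [conePoint] using hc.symm

theorem quad_conePoint (φ : ℝ) : quad (conePoint φ) = 0 := by
  have h := Real.sin_sq_add_cos_sq φ
  simp [quad, conePoint]
  linarith

theorem angle_smul {a : ℝ} (ha : 0 < a) (k : Fin 3 → ℝ) : angle (a • k) = angle k := by
  have h : (⟨(a • k) 2, (a • k) 1⟩ : ℂ) = (a : ℂ) * ⟨k 2, k 1⟩ := by
    apply Complex.ext <;> simp
  rw [angle, h, Complex.arg_real_mul _ ha, angle]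

/-- `SO₀(2,1)` preserves the upper cone. -/
theorem mat_conePoint_pos (g : G) (φ : ℝ) : 0 < (mat g *ᵥ conePoint φ) 0 := by
  have hne : ∀ x : ↥O21,
      (((x : GL (Fin 3) ℝ) : Matrix (Fin 3) (Fin 3) ℝ) *ᵥ conePoint φ) 0 ≠ 0 := by
    intro x h0
    set v := ((x : GL (Fin 3) ℝ) : Matrix (Fin 3) (Fin 3) ℝ) *ᵥ conePoint φ with hv
    have hq : quad v = 0 := by rw [hv, x.2 (conePoint φ), quad_conePoint]
    unfold quad at hq
    rw [h0] at hq
    have h1 : v 1 = 0 := by nlinarith [sq_nonneg (v 1), sq_nonneg (v 2)]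
    have h2 : v 2 = 0 := by nlinarith [sq_nonneg (v 1), sq_nonneg (v 2)]
    have hv0 : v = 0 := by
      ext i
      fin_cases i
      · exact h0
      · exact h1
      · exact h2
    have hk : ((((x : GL (Fin 3) ℝ)⁻¹ : GL (Fin 3) ℝ)) : Matrix (Fin 3) (Fin 3) ℝ) *ᵥ v
        = conePoint φ := by
      rw [hv, Matrix.mulVec_mulVec, ← Units.val_mul, inv_mul_cancel]
      simp
    rw [hv0, Matrix.mulVec_zero] at hk
    have := congrFun hk 0
    simp [conePoint] at this
  have hcont : Continuous fun x : ↥O21 =>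
      (((x : GL (Fin 3) ℝ) : Matrix (Fin 3) (Fin 3) ℝ) *ᵥ conePoint φ) 0 :=
    (continuous_apply 0).comp
      ((Units.continuous_val.comp continuous_subtype_val).matrix_mulVec continuous_const)
  have hpre := (isPreconnected_connectedComponent (x := (1 : ↥O21))).image _ hcont.continuousOn
  by_contra hle
  rw [not_lt] at hle
  have h0 := hpre.ordConnected.out ⟨(g : ↥O21), g.2, rfl⟩ ⟨1, mem_connectedComponent, rfl⟩
    (show (0 : ℝ) ∈ _ from ⟨hle, by simp [conePoint]⟩)
  obtain ⟨x, -, hx⟩ := h0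
  exact hne x hx

/-- The space `F^σ` of smooth functions on the circle, as smooth `2π`-periodic functions of `φ`. -/
noncomputable def SmoothCircle : Submodule ℂ (ℝ → ℂ) where
  carrier := {f | ContDiff ℝ ∞ f ∧ Function.Periodic f (2 * Real.pi)}
  zero_mem' := ⟨contDiff_const, fun _ => rfl⟩
  add_mem' := fun ha hb => ⟨ha.1.add hb.1, ha.2.add hb.2⟩
  smul_mem' := fun c _ ha => ⟨contDiff_const.smul ha.1, fun x => by
    simp only [Pi.smul_apply, ha.2 x]⟩

/-- The function `F(k) = k₀^σ f(angle k)` on the upper cone, homogeneous of degree `σ`,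
attached to the function `f` on the circle. -/
noncomputable def coneExt (σ : ℝ) (f : ℝ → ℂ) (k : Fin 3 → ℝ) : ℂ :=
  ((k 0 ^ σ : ℝ) : ℂ) * f (angle k)

theorem coneExt_smul (σ : ℝ) (f : ℝ → ℂ) {a : ℝ} (ha : 0 < a) {k : Fin 3 → ℝ} (hk : 0 < k 0) :
    coneExt σ f (a • k) = ((a ^ σ : ℝ) : ℂ) * coneExt σ f k := by
  simp only [coneExt, angle_smul ha, Pi.smul_apply, smul_eq_mul, Real.mul_rpow ha.le hk.le]
  push_cast
  ring

theorem periodic_congr {f : ℝ → ℂ} (hf : Function.Periodic f (2 * Real.pi)) {x y : ℝ}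
    (h : (x : Real.Angle) = y) : f x = f y := by
  obtain ⟨n, hn⟩ := Real.Angle.angle_eq_iff_two_pi_dvd_sub.1 h
  have : x = y + n * (2 * Real.pi) := by linarith
  rw [this]
  exact (hf.int_mul n) y

theorem conePoint_angle (φ : ℝ) : (angle (conePoint φ) : Real.Angle) = φ := by
  have h : (⟨conePoint φ 2, conePoint φ 1⟩ : ℂ)
      = ((Real.cos φ : ℝ) : ℂ) + ((Real.sin φ : ℝ) : ℂ) * Complex.I := by
    apply Complex.ext <;> simp [conePoint, -Complex.ofReal_cos, -Complex.ofReal_sin]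
  rw [angle, h]
  simpa using Complex.arg_cos_add_sin_mul_I_coe_angle (φ : Real.Angle)

theorem contDiff_comp_arg {f : ℝ → ℂ} (hf : ContDiff ℝ ∞ f)
    (hp : Function.Periodic f (2 * Real.pi)) {z : ℂ} (hz : z ≠ 0) :
    ContDiffAt ℝ ∞ (fun w : ℂ => f (Complex.arg w)) z := by
  -- near `z`, `arg w` equals `arg (w / z) + arg z` modulo `2π`, and `w / z` is near `1`
  have hloc : (fun w : ℂ => f (Complex.arg w)) =ᶠ[𝓝 z]
      fun w => f ((Complex.log (w * z⁻¹)).im + Complex.arg z) := by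
    filter_upwards [isOpen_ne.mem_nhds hz] with w hw
    apply periodic_congr hp
    rw [Complex.log_im, Real.Angle.coe_add, ← Complex.arg_mul_coe_angle
      (mul_ne_zero hw (inv_ne_zero hz)) hz, inv_mul_cancel_right₀ hz]
  refine ContDiffAt.congr_of_eventuallyEq ?_ hloc
  refine hf.contDiffAt.comp z ?_
  have hlog : ContDiffAt ℝ ∞ Complex.log (z * z⁻¹) := by
    rw [mul_inv_cancel₀ hz]
    exact (Complex.contDiffAt_log (n := ∞) Complex.one_mem_slitPlane).restrict_scalars ℝ
  have h1 : ContDiffAt ℝ ∞ (fun w : ℂ => Complex.log (w * z⁻¹)) z :=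
    ContDiffAt.comp z (g := Complex.log) (f := fun w : ℂ => w * z⁻¹) hlog
      (contDiffAt_id.mul contDiffAt_const)
  exact (Complex.imCLM.contDiff.contDiffAt.comp z h1).add contDiffAt_const

theorem smooth_action (σ : ℝ) (g : G) {f : ℝ → ℂ} (hf : f ∈ SmoothCircle) :
    (fun φ => coneExt σ f (mat g *ᵥ conePoint φ)) ∈ SmoothCircle := by
  have hsm : ∀ i, ContDiff ℝ ∞ fun φ => (mat g *ᵥ conePoint φ) i := by
    intro i
    simp only [conePoint, Matrix.mulVec, dotProduct, Fin.sum_univ_three]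
    simp only [Matrix.cons_val]
    exact ((contDiff_const.mul contDiff_const).add (contDiff_const.mul Real.contDiff_sin)).add
      (contDiff_const.mul Real.contDiff_cos)
  constructor
  · rw [contDiff_iff_contDiffAt]
    intro φ
    have hpos := mat_conePoint_pos g φ
    refine ContDiffAt.mul ?_ ?_
    · refine Complex.ofRealCLM.contDiff.contDiffAt.comp φ ?_
      exact (hsm 0).contDiffAt.rpow_const_of_ne hpos.ne'
    · have hz : (⟨(mat g *ᵥ conePoint φ) 2, (mat g *ᵥ conePoint φ) 1⟩ : ℂ) ≠ 0 := by
        intro h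
        have hre := congrArg Complex.re h
        have him := congrArg Complex.im h
        have hq : quad (mat g *ᵥ conePoint φ) = 0 := by rw [quad_mat, quad_conePoint]
        simp only [Complex.zero_re, Complex.zero_im] at hre him
        unfold quad at hq
        rw [hre, him] at hq
        nlinarith
      have hmk : ContDiff ℝ ∞ fun φ : ℝ =>
          (⟨(mat g *ᵥ conePoint φ) 2, (mat g *ᵥ conePoint φ) 1⟩ : ℂ) := by
        have h := (Complex.ofRealCLM.contDiff.comp (hsm 2)).add
          ((Complex.ofRealCLM.contDiff.comp (hsm 1)).mul (contDiff_const (c := Complex.I)))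
        convert h using 1
        funext x
        apply Complex.ext <;> simp
      exact ContDiffAt.comp φ (g := fun w : ℂ => f (Complex.arg w))
        (contDiff_comp_arg hf.1 hf.2 hz) hmk.contDiffAt
  · intro φ
    simp [conePoint]

/-- The representation `T(g)F(k) = F(g⁻¹ k)` of `SO₀(2,1)` on homogeneous functions of degree `σ`
on the upper cone, written on functions on the circle, `F(k) = k₀^σ f(angle k)`. -/
noncomputable def rep (σ : ℝ) : Representation ℂ G SmoothCircle where
  toFun g :=
    { toFun := fun f => ⟨fun φ => coneExt σ f (mat g⁻¹ *ᵥ conePoint φ), smooth_action σ g⁻¹ f.2⟩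
      map_add' := fun f₁ f₂ => by
        apply Subtype.ext
        funext φ
        simp [coneExt, mul_add]
      map_smul' := fun c f => by
        apply Subtype.ext
        funext φ
        simp [coneExt, mul_left_comm] }
  map_one' := by
    apply LinearMap.ext
    intro f
    apply Subtype.ext
    funext φ
    have h : (f : ℝ → ℂ) (angle (conePoint φ)) = (f : ℝ → ℂ) φ :=
      periodic_congr f.2.2 (conePoint_angle φ)
    simp only [LinearMap.coe_mk, AddHom.coe_mk, inv_one, mat_one, Matrix.one_mulVec, coneExt, h]
    simp [conePoint]
  map_mul' g₁ g₂ := by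
    apply LinearMap.ext
    intro f
    apply Subtype.ext
    funext φ
    have hpos := mat_conePoint_pos g₁⁻¹ φ
    have hq : quad (mat g₁⁻¹ *ᵥ conePoint φ) = 0 := by rw [quad_mat, quad_conePoint]
    have hk := eq_smul_conePoint hq hpos
    change coneExt σ f (mat (g₁ * g₂)⁻¹ *ᵥ conePoint φ) =
      coneExt σ (fun ψ => coneExt σ f (mat g₂⁻¹ *ᵥ conePoint ψ)) (mat g₁⁻¹ *ᵥ conePoint φ)
    rw [mul_inv_rev, mat_mul, ← Matrix.mulVec_mulVec]
    conv_lhs => rw [hk, Matrix.mulVec_smul]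
    rw [coneExt_smul σ f hpos (mat_conePoint_pos g₂⁻¹ _)]
    rfl

theorem rep_apply (σ : ℝ) (g : G) (f : SmoothCircle) (φ : ℝ) :
    (rep σ g f : ℝ → ℂ) φ = coneExt σ f (mat g⁻¹ *ᵥ conePoint φ) := rfl

/-- The Fourier coefficient `f_m` in `f(φ) = ∑ f_m e^{imφ}`. -/
noncomputable def fourierC (f : SmoothCircle) (m : ℤ) : ℂ :=
  (1 / (2 * Real.pi) : ℂ) *
    ∫ φ in (0 : ℝ)..(2 * Real.pi), (f : ℝ → ℂ) φ * Complex.exp (-(Complex.I * m * φ))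

/-- The diagonal weights `Φ_m = Γ(m + σ + 1) / Γ(m - σ)`; meaningful for non-integer `σ`. -/
noncomputable def Phi (σ : ℝ) (m : ℤ) : ℝ := Real.Gamma (m + σ + 1) / Real.Gamma (m - σ)

/-- The canonical (diagonal) form of the invariant form with constant `c₀`. -/
noncomputable def diagForm (c₀ σ : ℝ) (f₁ f₂ : SmoothCircle) : ℂ :=
  ((c₀ * 2 ^ (-σ - 1) / (Real.sqrt Real.pi * Real.Gamma (σ + 1)) : ℝ) : ℂ) *
    ∑' m : ℤ, (Phi σ m : ℂ) * conj (fourierC f₁ m) * fourierC f₂ m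

/-- The integrand of the integral representation of the invariant form. -/
noncomputable def kernelIntegrand (σ : ℝ) (f₁ f₂ : SmoothCircle) (φ₁ φ₂ : ℝ) : ℂ :=
  (((1 - Real.cos (φ₁ - φ₂)) ^ (-σ - 1) : ℝ) : ℂ) *
    conj ((f₁ : ℝ → ℂ) φ₁) * (f₂ : ℝ → ℂ) φ₂

/-- The integral representation of the invariant form; absolutely convergent for `σ < -1/2`. -/
noncomputable def integralForm (c₀ σ : ℝ) (f₁ f₂ : SmoothCircle) : ℂ :=
  ((c₀ / (4 * Real.pi ^ 2 * Real.Gamma (-σ - 1 / 2)) : ℝ) : ℂ) *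
    ∫ φ₁ in (0 : ℝ)..(2 * Real.pi), ∫ φ₂ in (0 : ℝ)..(2 * Real.pi), kernelIntegrand σ f₁ f₂ φ₁ φ₂

/-- `B` is a scalar product: linear in the second argument, Hermitian, positive definite. -/
structure IsScalarProduct {V : Type*} [AddCommGroup V] [Module ℂ V] (B : V → V → ℂ) : Prop where
  add_right : ∀ u v w, B u (v + w) = B u v + B u w
  smul_right : ∀ (c : ℂ) (u v), B u (c • v) = c * B u v
  conj_symm : ∀ u v, conj (B v u) = B u v
  pos : ∀ u, u ≠ 0 → 0 < (B u u).re

/-- A subspace of the space of smooth functions on the circle is closed (for uniform convergence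
of all derivatives; this topology is metrizable, so sequences suffice). -/
def IsSmoothClosed (W : Submodule ℂ SmoothCircle) : Prop :=
  ∀ (u : ℕ → SmoothCircle) (f : SmoothCircle), (∀ n, u n ∈ W) →
    (∀ k : ℕ, TendstoUniformly (fun n => iteratedDeriv k (u n : ℝ → ℂ))
      (iteratedDeriv k (f : ℝ → ℂ)) atTop) → f ∈ W

/-- Irreducibility in the space of smooth functions: no proper nonzero closed invariant subspace. -/
def IsSmoothIrreducible (ρ : Representation ℂ G SmoothCircle) : Prop :=
  ∀ W : Submodule ℂ SmoothCircle, IsSmoothClosed W → (∀ g, ∀ f ∈ W, ρ g f ∈ W) → W = ⊥ ∨ W = ⊤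

/-- On the Hilbert space completion `H` of `V` with respect to `B`, the operators `ρ g` extend to a
strongly continuous unitary representation that has no proper nonzero closed invariant subspace. -/
def IsIrreducibleUnitary {V : Type*} [AddCommGroup V] [Module ℂ V] (ρ : Representation ℂ G V)
    (B : V → V → ℂ) : Prop :=
  ∃ (H : Type) (_ : NormedAddCommGroup H) (_ : InnerProductSpace ℂ H) (_ : CompleteSpace H)
    (ι : V →ₗ[ℂ] H) (U : G →* (H ≃ₗᵢ[ℂ] H)),
    (∀ u v, inner ℂ (ι u) (ι v) = B u v) ∧
    DenseRange ι ∧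
    (∀ g v, U g (ι v) = ι (ρ g v)) ∧
    (∀ x, Continuous fun g => U g x) ∧
    Nontrivial H ∧
    ∀ W : Submodule ℂ H, IsClosed (W : Set H) → (∀ g, ∀ x ∈ W, U g x ∈ W) → W = ⊥ ∨ W = ⊤

end SO21

open SO21

/-!
Everything is read off the Fourier coefficients. The weights `Φ_m = Γ(m + σ + 1) / Γ(m - σ)` satisfy
the recurrence `Φ_{m+1} (m - σ) = Φ_m (m + 1 + σ)`, so that `Φ_m = Φ_0 w_m` with `w_m` a product of
the factors `(j + 1 + σ) / (j - σ)`, `0 ≤ j < |m|` (`eq_mul_weight`). For `-1 < σ < 0` the factors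
are positive, which gives positivity of the form, and at most `(j + 1) / j` for `j ≥ 1`, which gives
linear growth of `w_m` and convergence. Outside the strip the ratio `Φ_1 / Φ_0 = (σ + 1) / (-σ)` has
the wrong sign, or degenerates at `σ = 0, -1`, and the vectors `1` and `e^{iφ}` suffice to exclude a
scalar product (`isScalarProduct_diagForm_iff`, `not_isScalarProduct_limit`).

*Invariance.* Rotations multiply the coefficients by phases, and by the Cartan decomposition it
remains to treat boosts. Their generator `X f = sin φ f' - σ cos φ f` acts on coefficients as a
two-term difference operator, and the recurrence of the weights says that the series for
`(X f₁, f₂) + (f₁, X f₂)` telescopes (`tsum_boostGen_skew`). Hence `(T(h(α)) f₁, T(h(α)) f₂)` has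
derivative zero in `α`; differentiation under the sum is allowed since `T(h(α)) f` is jointly smooth
in `α` and `φ`, so that its coefficients decay locally uniformly in `α`.

*Irreducibility.* A closed subspace invariant under rotations contains the Fourier components of its
elements. The coefficients of `T(h(α)) e^{imφ}` at `m ± 1` have derivatives `(m - σ) / 2` and
`-(m + σ) / 2` at `α = 0`, which do not vanish for non-integer `σ`; so a nonzero invariant closed
subspace contains all exponentials. This works in the space of smooth functions and in the
completion, which is realized as `ℓ²(ℤ)` through the coefficients `√(A Φ_m / Φ_0) f_m`.

*Integral form.* Integration by parts in `∫ sin^{2s} y e^{-2imy} dy`, `s = -σ - 1`, shows that the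
Fourier coefficients of the kernel `(1 - cos x)^s` satisfy the recurrence of the weights
(`kernelCoeff_succ`); the zeroth one is a beta integral. Analyticity in `σ` holds because the series
converges locally uniformly for complex `σ` in the strip `-1 < re σ < 0`.
-/

/-! ### The Cartan decomposition of `SO₀(2,1)` -/

theorem mat_injective : Function.Injective mat := fun _ _ h =>
  Subtype.ext (Subtype.ext (Units.ext h))

theorem mat_rot (θ : ℝ) : mat (rot θ) = rotMat θ := rfl

theorem mat_boost (α : ℝ) : mat (boost α) = boostMat α := rfl

theorem mat_rot_inv (θ : ℝ) : mat (rot θ)⁻¹ = rotMat (-θ) := rfl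

theorem mat_boost_inv (α : ℝ) : mat (boost α)⁻¹ = boostMat (-α) := rfl

/-- A continuous function without zeros on `O(2,1)` keeps its sign on `SO₀(2,1)`. -/
theorem pos_of_continuous_of_ne_zero (F : ↥O21 → ℝ) (hF : Continuous F) (hne : ∀ x, F x ≠ 0)
    (h1 : 0 < F 1) (g : G) : 0 < F g := by
  by_contra hle
  rw [not_lt] at hle
  have hpre := (isPreconnected_connectedComponent (x := (1 : ↥O21))).image _ hF.continuousOn
  obtain ⟨x, -, hx⟩ := hpre.ordConnected.out ⟨(g : ↥O21), g.2, rfl⟩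
    ⟨1, mem_connectedComponent, rfl⟩ (show (0 : ℝ) ∈ _ from ⟨hle, h1.le⟩)
  exact hne x hx

theorem mat_det_pos (g : G) : 0 < (mat g).det := by
  refine pos_of_continuous_of_ne_zero
    (fun x => ((x : GL (Fin 3) ℝ) : Matrix (Fin 3) (Fin 3) ℝ).det)
    (Continuous.matrix_det (Units.continuous_val.comp continuous_subtype_val)) (fun x => ?_)
    (by simp) g
  exact ((Matrix.isUnit_iff_isUnit_det _).1 (Units.isUnit (x : GL (Fin 3) ℝ))).ne_zero

theorem mat_zero_zero_pos (g : G) : 0 < mat g 0 0 := by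
  refine pos_of_continuous_of_ne_zero
    (fun x => ((x : GL (Fin 3) ℝ) : Matrix (Fin 3) (Fin 3) ℝ) 0 0) ?_ (fun x => ?_)
    (by simp) g
  · exact (Units.continuous_val.comp continuous_subtype_val).matrix_elem 0 0
  · intro h
    have hq := x.2 ![1, 0, 0]
    simp [quad, Matrix.mulVec, dotProduct, Fin.sum_univ_three] at hq
    rw [h] at hq
    nlinarith [sq_nonneg (((x : GL (Fin 3) ℝ) : Matrix (Fin 3) (Fin 3) ℝ) 1 0),
      sq_nonneg (((x : GL (Fin 3) ℝ) : Matrix (Fin 3) (Fin 3) ℝ) 2 0)]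

theorem exists_cos_sin {x y : ℝ} (h : x ^ 2 + y ^ 2 = 1) :
    ∃ θ : ℝ, x = Real.cos θ ∧ y = Real.sin θ := by
  have hn : ‖(⟨x, y⟩ : ℂ)‖ = 1 := by
    rw [Complex.norm_def, Complex.normSq_mk, Real.sqrt_eq_one]; linarith
  have hz : (⟨x, y⟩ : ℂ) ≠ 0 := by
    intro h'; rw [h', norm_zero] at hn; exact zero_ne_one hn
  refine ⟨Complex.arg ⟨x, y⟩, ?_, ?_⟩
  · rw [Complex.cos_arg hz, hn]; simp
  · rw [Complex.sin_arg, hn]; simp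

/-- The stabilizer of the time axis in `SO₀(2,1)` consists of rotations. -/
theorem exists_rot_of_fix (g : G) (h0 : mat g 0 0 = 1) (h1 : mat g 1 0 = 0)
    (h2 : mat g 2 0 = 0) : ∃ θ, g = rot θ := by
  have q (x y : ℝ) : (1 + mat g 0 1 * x + mat g 0 2 * y) ^ 2 - (mat g 1 1 * x + mat g 1 2 * y) ^ 2
      - (mat g 2 1 * x + mat g 2 2 * y) ^ 2 = 1 - x ^ 2 - y ^ 2 := by
    have := quad_mat g ![1, x, y]
    simpa [quad, Matrix.mulVec, dotProduct, Fin.sum_univ_three, h0, h1, h2] using this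
  have h01 : mat g 0 1 = 0 := by linarith [q 1 0, q (-1) 0]
  have h02 : mat g 0 2 = 0 := by linarith [q 0 1, q 0 (-1)]
  rw [h01, h02] at q
  have ha := q 1 0
  have hb := q 0 1
  have hc := q 1 1
  have hd := mat_det_pos g
  rw [Matrix.det_fin_three, h0, h1, h2, h01, h02] at hd
  obtain ⟨θ, hcos, hsin⟩ : ∃ θ : ℝ, mat g 1 1 = Real.cos θ ∧ -mat g 2 1 = Real.sin θ :=
    exists_cos_sin (by linarith)
  have h21 : mat g 2 1 = -Real.sin θ := by linarith
  rw [hcos, h21] at ha hc hd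
  have hcs := Real.sin_sq_add_cos_sq θ
  set c := Real.cos θ
  set s := Real.sin θ
  have horth : c * mat g 1 2 - s * mat g 2 2 = 0 := by nlinarith
  have ht2 : (c * mat g 2 2 + s * mat g 1 2) ^ 2 = 1 := by
    have : (c * mat g 2 2 + s * mat g 1 2) ^ 2 + (c * mat g 1 2 - s * mat g 2 2) ^ 2
        = (s ^ 2 + c ^ 2) * ((mat g 1 2) ^ 2 + (mat g 2 2) ^ 2) := by ring
    rw [horth, hcs] at this
    linarith
  have ht : c * mat g 2 2 + s * mat g 1 2 = 1 := by nlinarith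
  have h12 : mat g 1 2 = s := by linear_combination s * ht + c * horth - mat g 1 2 * hcs
  have h22 : mat g 2 2 = c := by linear_combination c * ht - s * horth - mat g 2 2 * hcs
  refine ⟨θ, mat_injective ?_⟩
  rw [mat_rot]
  ext i j
  fin_cases i <;> fin_cases j <;> simp [rotMat, *, c, s]

theorem cartan_decomposition (g : G) : ∃ φ₁ α φ₂ : ℝ, g = rot φ₁ * boost α * rot φ₂ := by
  have hq := quad_mat g ![1, 0, 0]
  simp [quad, Matrix.mulVec, dotProduct, Fin.sum_univ_three] at hq
  have h0 := mat_zero_zero_pos g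
  -- `g (1, 0, 0) = (cosh α, sinh α sin ψ, sinh α cos ψ)`
  set r : ℝ := ‖(⟨mat g 2 0, mat g 1 0⟩ : ℂ)‖ with hr
  set ψ : ℝ := Complex.arg ⟨mat g 2 0, mat g 1 0⟩ with hψ
  have hc : mat g 2 0 = r * Real.cos ψ := by
    exact (Complex.norm_mul_cos_arg (⟨mat g 2 0, mat g 1 0⟩ : ℂ)).symm
  have hs : mat g 1 0 = r * Real.sin ψ := by
    exact (Complex.norm_mul_sin_arg (⟨mat g 2 0, mat g 1 0⟩ : ℂ)).symm
  set α := Real.arsinh r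
  have hsinh : Real.sinh α = r := Real.sinh_arsinh r
  have hcosh : Real.cosh α = mat g 0 0 := by
    rw [Real.cosh_arsinh, Real.sqrt_eq_iff_mul_self_eq_of_pos h0]
    have := Real.sin_sq_add_cos_sq ψ
    rw [hc, hs] at hq
    linear_combination hq + r ^ 2 * this
  have hfix : mat ((rot ψ * boost α)⁻¹ * g) *ᵥ ![1, 0, 0] = ![1, 0, 0] := by
    have : mat g *ᵥ ![1, 0, 0] = mat (rot ψ * boost α) *ᵥ ![1, 0, 0] := by
      rw [mat_mul, mat_rot, mat_boost]
      ext i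
      fin_cases i <;>
        simp [Matrix.mulVec, dotProduct, Fin.sum_univ_three, rotMat, boostMat, Matrix.mul_apply,
          hsinh, hcosh, hc, hs, mul_comm]
    rw [mat_mul, ← Matrix.mulVec_mulVec, this, mat_inv_mulVec]
  have e0 := congrFun hfix 0
  have e1 := congrFun hfix 1
  have e2 := congrFun hfix 2
  simp [Matrix.mulVec, dotProduct, Fin.sum_univ_three] at e0 e1 e2
  obtain ⟨θ, hθ⟩ := exists_rot_of_fix _ e0 e1 e2
  exact ⟨ψ, α, θ, by rw [← hθ]; group⟩

theorem coneExt_of_eq_smul (σ : ℝ) {f : ℝ → ℂ} (hf : Function.Periodic f (2 * Real.pi)) {w ψ : ℝ}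
    (hw : 0 < w) {k : Fin 3 → ℝ} (hk : k = w • conePoint ψ) :
    coneExt σ f k = ((w ^ σ : ℝ) : ℂ) * f ψ := by
  rw [hk, coneExt_smul σ f hw (by simp [conePoint]), coneExt,
    periodic_congr hf (conePoint_angle ψ)]
  simp [conePoint]

theorem rep_rot_apply (σ : ℝ) (f : SmoothCircle) (θ φ : ℝ) :
    (rep σ (rot θ) f : ℝ → ℂ) φ = (f : ℝ → ℂ) (φ - θ) := by
  rw [rep_apply, coneExt_of_eq_smul σ f.2.2 one_pos (ψ := φ - θ)]
  · simp
  · rw [mat_rot_inv]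
    ext i
    fin_cases i <;> simp [conePoint, rotMat, Matrix.mulVec, dotProduct, Fin.sum_univ_three,
      Real.sin_sub, Real.cos_sub] <;> ring

/-- The scaling factor of the boost `h(α)` on the cone. -/
theorem cosh_sub_sinh_mul_cos_pos (α φ : ℝ) : 0 < Real.cosh α - Real.sinh α * Real.cos φ := by
  have h := mat_conePoint_pos (boost α)⁻¹ φ
  rw [mat_boost_inv] at h
  simpa [conePoint, boostMat, Matrix.mulVec, dotProduct, Fin.sum_univ_three, sub_eq_add_neg] using h

theorem boostMat_neg_mulVec (α φ : ℝ) : boostMat (-α) *ᵥ conePoint φ =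
    ![Real.cosh α - Real.sinh α * Real.cos φ, Real.sin φ,
      -Real.sinh α + Real.cosh α * Real.cos φ] := by
  ext i
  fin_cases i <;>
    simp [conePoint, boostMat, Matrix.mulVec, dotProduct, Fin.sum_univ_three, sub_eq_add_neg]

theorem rep_boost_apply (σ : ℝ) (f : SmoothCircle) (φ α w : ℝ)
    (hw : w = Real.cosh α - Real.sinh α * Real.cos φ) :
    0 < w ∧ ∃ ψ : ℝ, Real.sin ψ = Real.sin φ / w ∧
      Real.cos ψ = (-Real.sinh α + Real.cosh α * Real.cos φ) / w ∧
      (rep σ (boost α) f : ℝ → ℂ) φ = ((w ^ σ : ℝ) : ℂ) * (f : ℝ → ℂ) ψ := by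
  have hpos : 0 < w := hw ▸ cosh_sub_sinh_mul_cos_pos α φ
  refine ⟨hpos, ?_⟩
  set k := mat (boost α)⁻¹ *ᵥ conePoint φ with hkdef
  have hk : k = ![w, Real.sin φ, -Real.sinh α + Real.cosh α * Real.cos φ] := by
    rw [hkdef, mat_boost_inv, boostMat_neg_mulVec, hw]
  have hq : quad k = 0 := by rw [hkdef, quad_mat, quad_conePoint]
  have hk0 : k 0 = w := by rw [hk]; rfl
  have h := eq_smul_conePoint hq (hk0 ▸ hpos)
  rw [hk0] at h
  refine ⟨angle k, ?_, ?_, ?_⟩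
  · have h1 := congrFun h 1
    rw [eq_div_iff hpos.ne']
    rw [hk] at h1 ⊢
    simpa [conePoint, mul_comm] using h1.symm
  · have h2 := congrFun h 2
    rw [eq_div_iff hpos.ne']
    rw [hk] at h2 ⊢
    simpa [conePoint, mul_comm] using h2.symm
  · rw [rep_apply]
    exact coneExt_of_eq_smul σ f.2.2 hpos h

/-! ### Fourier coefficients of smooth functions on the circle -/

theorem continuous_circle (f : SmoothCircle) : Continuous (f : ℝ → ℂ) := f.2.1.continuous

theorem differentiable_circle (f : SmoothCircle) : Differentiable ℝ (f : ℝ → ℂ) :=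
  f.2.1.differentiable (by simp)

theorem intervalIntegrable_mul_exp {f : ℝ → ℂ} (hf : Continuous f) (m : ℤ) (a b : ℝ) :
    IntervalIntegrable (fun φ : ℝ => f φ * Complex.exp (-(Complex.I * m * φ))) volume a b :=
  Continuous.intervalIntegrable (by fun_prop) _ _

theorem norm_exp_neg_I_mul_int_mul (m : ℤ) (φ : ℝ) :
    ‖Complex.exp (-(Complex.I * m * φ))‖ = 1 := by
  rw [Complex.norm_exp]; simp

theorem norm_exp_I_mul_int_mul (m : ℤ) (φ : ℝ) :
    ‖Complex.exp (Complex.I * m * φ)‖ = 1 := by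
  rw [Complex.norm_exp]; simp

theorem exp_I_mul_int_mul_add_two_pi (m : ℤ) (φ : ℝ) :
    Complex.exp (Complex.I * m * ((φ + 2 * Real.pi : ℝ) : ℂ)) = Complex.exp (Complex.I * m * φ) :=
  Complex.exp_eq_exp_iff_exists_int.2 ⟨m, by push_cast; ring⟩

/-- The Fourier coefficient as a linear functional. -/
noncomputable def fourierL (m : ℤ) : SmoothCircle →ₗ[ℂ] ℂ where
  toFun f := fourierC f m
  map_add' f g := by
    simp only [fourierC, Submodule.coe_add, Pi.add_apply, add_mul]
    rw [intervalIntegral.integral_add (intervalIntegrable_mul_exp (continuous_circle f) _ _ _)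
      (intervalIntegrable_mul_exp (continuous_circle g) _ _ _), mul_add]
  map_smul' c f := by
    simp only [fourierC, Submodule.coe_smul, Pi.smul_apply, smul_eq_mul, mul_assoc,
      intervalIntegral.integral_const_mul, RingHom.id_apply]
    ring

theorem fourierL_apply (m : ℤ) (f : SmoothCircle) : fourierL m f = fourierC f m := rfl

theorem fourierC_add (f g : SmoothCircle) (m : ℤ) :
    fourierC (f + g) m = fourierC f m + fourierC g m := (fourierL m).map_add f g

theorem fourierC_sub (f g : SmoothCircle) (m : ℤ) :
    fourierC (f - g) m = fourierC f m - fourierC g m := (fourierL m).map_sub f g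

theorem fourierC_smul (c : ℂ) (f : SmoothCircle) (m : ℤ) :
    fourierC (c • f) m = c * fourierC f m := (fourierL m).map_smul c f

theorem fourierC_sum {ι : Type*} (s : Finset ι) (f : ι → SmoothCircle) (m : ℤ) :
    fourierC (∑ i ∈ s, f i) m = ∑ i ∈ s, fourierC (f i) m := map_sum (fourierL m) f s

theorem norm_fourierC_le (f : SmoothCircle) {C : ℝ} (hC : ∀ φ, ‖(f : ℝ → ℂ) φ‖ ≤ C) (m : ℤ) :
    ‖fourierC f m‖ ≤ C := by
  have h := intervalIntegral.norm_integral_le_of_norm_le_const (a := 0) (b := 2 * Real.pi)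
    (f := fun φ : ℝ => (f : ℝ → ℂ) φ * Complex.exp (-(Complex.I * m * φ))) (C := C)
    (fun φ _ => by rw [norm_mul, norm_exp_neg_I_mul_int_mul, mul_one]; exact hC φ)
  have hpi := Real.pi_pos
  rw [sub_zero, abs_of_pos (by positivity)] at h
  rw [fourierC, norm_mul]
  have : ‖(1 / (2 * Real.pi) : ℂ)‖ = 1 / (2 * Real.pi) := by
    rw [norm_div, norm_mul]; simp [abs_of_pos hpi]
  rw [this]
  calc 1 / (2 * Real.pi) * _ ≤ 1 / (2 * Real.pi) * (C * (2 * Real.pi)) := by gcongr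
    _ = C := by field_simp

theorem exists_bound_circle (f : SmoothCircle) : ∃ C, ∀ φ, ‖(f : ℝ → ℂ) φ‖ ≤ C := by
  obtain ⟨C, hC⟩ := (isCompact_Icc (a := (0 : ℝ)) (b := 2 * Real.pi)).exists_bound_of_continuousOn
    (continuous_circle f).continuousOn
  refine ⟨C, fun φ => ?_⟩
  obtain ⟨y, hy, hxy⟩ := f.2.2.exists_mem_Ico₀ Real.two_pi_pos φ
  rw [hxy]
  exact hC y ⟨hy.1, hy.2.le⟩

/-- The derivative `d/dφ` on smooth functions on the circle. -/
noncomputable def derivCircle (f : SmoothCircle) : SmoothCircle :=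
  ⟨deriv (f : ℝ → ℂ), (contDiff_infty_iff_deriv.1 f.2.1).2, fun x => by
    rw [← deriv_comp_add_const]
    congr 1
    funext y
    exact f.2.2 y⟩

theorem coe_derivCircle (f : SmoothCircle) : (derivCircle f : ℝ → ℂ) = deriv (f : ℝ → ℂ) := rfl

theorem fourierC_derivCircle (f : SmoothCircle) (m : ℤ) :
    fourierC (derivCircle f) m = Complex.I * m * fourierC f m := by
  have hder (φ : ℝ) : HasDerivAt (fun φ : ℝ => Complex.exp (-(Complex.I * m * φ)))
      (-(Complex.I * m) * Complex.exp (-(Complex.I * m * φ))) φ := by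
    have h : HasDerivAt (fun φ : ℝ => -(Complex.I * m * (φ : ℂ))) (-(Complex.I * m)) φ := by
      simpa using ((Complex.ofRealCLM.hasDerivAt (x := φ)).const_mul (Complex.I * (m : ℂ))).fun_neg
    simpa [mul_comm] using h.cexp
  have h := intervalIntegral.integral_mul_deriv_eq_deriv_mul (a := 0) (b := 2 * Real.pi)
    (u := fun φ : ℝ => Complex.exp (-(Complex.I * m * φ))) (v := (f : ℝ → ℂ))
    (u' := fun φ : ℝ => -(Complex.I * m) * Complex.exp (-(Complex.I * m * φ)))
    (v' := deriv (f : ℝ → ℂ)) (fun φ _ => hder φ)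
    (fun φ _ => (differentiable_circle f φ).hasDerivAt)
    (Continuous.intervalIntegrable (by fun_prop) _ _)
    ((continuous_circle (derivCircle f)).intervalIntegrable _ _)
  have hper : (f : ℝ → ℂ) (2 * Real.pi) = (f : ℝ → ℂ) 0 := by simpa using f.2.2 0
  have hexp : Complex.exp (-(Complex.I * m * ((2 * Real.pi : ℝ) : ℂ))) = 1 := by
    rw [Complex.exp_eq_one_iff]
    exact ⟨-m, by push_cast; ring⟩
  rw [hper, hexp] at h
  simp only [Complex.ofReal_zero, mul_zero, neg_zero, Complex.exp_zero, one_mul, sub_self,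
    zero_sub] at h
  rw [fourierC, fourierC, coe_derivCircle]
  simp only [mul_comm _ (Complex.exp _)]
  rw [h, ← intervalIntegral.integral_neg]
  simp only [mul_assoc, neg_mul, neg_neg, intervalIntegral.integral_const_mul]
  ring

theorem fourierC_iterate_derivCircle (f : SmoothCircle) (k : ℕ) (m : ℤ) :
    fourierC (derivCircle^[k] f) m = (Complex.I * m) ^ k * fourierC f m := by
  induction k with
  | zero => simp
  | succ k ih => rw [Function.iterate_succ_apply', fourierC_derivCircle, ih]; ring

theorem coe_iterate_derivCircle (f : SmoothCircle) (k : ℕ) :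
    (derivCircle^[k] f : ℝ → ℂ) = iteratedDeriv k (f : ℝ → ℂ) := by
  induction k with
  | zero => simp
  | succ k ih => rw [Function.iterate_succ_apply', coe_derivCircle, ih, iteratedDeriv_succ]

theorem norm_fourierC_iterate_derivCircle (f : SmoothCircle) (k : ℕ) (m : ℤ) :
    ‖fourierC (derivCircle^[k] f) m‖ = |(m : ℝ)| ^ k * ‖fourierC f m‖ := by
  rw [fourierC_iterate_derivCircle]; simp

theorem summable_inv_one_add_sq : Summable fun m : ℤ => (1 + (m : ℝ) ^ 2)⁻¹ := by
  refine Summable.of_norm_bounded_eventually (Real.summable_one_div_int_pow.2 one_lt_two) ?_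
  filter_upwards [(Set.finite_singleton (0 : ℤ)).compl_mem_cofinite] with m hm
  have hm0 : (m : ℝ) ≠ 0 := by exact_mod_cast hm
  have : 0 < (m : ℝ) ^ 2 := by positivity
  rw [Real.norm_of_nonneg (by positivity), one_div]
  gcongr
  linarith

/-- Decay of Fourier coefficients, with an explicit constant: this makes it locally uniform for
smooth families of functions. -/
theorem norm_fourierC_le_div (f : SmoothCircle) {C : ℝ} (h0 : ∀ φ, ‖(f : ℝ → ℂ) φ‖ ≤ C)
    (h2 : ∀ φ, ‖(derivCircle^[2] f : ℝ → ℂ) φ‖ ≤ C) (m : ℤ) :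
    ‖fourierC f m‖ ≤ 2 * C * (1 + (m : ℝ) ^ 2)⁻¹ := by
  have e0 := norm_fourierC_le f h0 m
  have e2 := norm_fourierC_le _ h2 m
  rw [norm_fourierC_iterate_derivCircle, sq_abs] at e2
  have hp : 0 < 1 + (m : ℝ) ^ 2 := by positivity
  rw [← div_eq_mul_inv, le_div_iff₀ hp]
  linarith

theorem exists_norm_fourierC_le_div (f : SmoothCircle) :
    ∃ C, ∀ m, ‖fourierC f m‖ ≤ C * (1 + (m : ℝ) ^ 2)⁻¹ := by
  obtain ⟨C₀, h0⟩ := exists_bound_circle f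
  obtain ⟨C₂, h2⟩ := exists_bound_circle (derivCircle^[2] f)
  exact ⟨2 * max C₀ C₂, norm_fourierC_le_div f (fun φ => (h0 φ).trans (le_max_left _ _))
    (fun φ => (h2 φ).trans (le_max_right _ _))⟩

theorem summable_norm_fourierC (f : SmoothCircle) : Summable fun m => ‖fourierC f m‖ := by
  obtain ⟨C, hC⟩ := exists_norm_fourierC_le_div f
  exact Summable.of_nonneg_of_le (fun _ => norm_nonneg _) hC (summable_inv_one_add_sq.mul_left C)

theorem summable_pow_mul_norm_fourierC (f : SmoothCircle) (k : ℕ) :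
    Summable fun m : ℤ => |(m : ℝ)| ^ k * ‖fourierC f m‖ := by
  simpa only [norm_fourierC_iterate_derivCircle] using
    summable_norm_fourierC (derivCircle^[k] f)

/-- The exponential `e^{imφ}`. -/
noncomputable def expCircle (m : ℤ) : SmoothCircle :=
  ⟨fun φ => Complex.exp (Complex.I * m * φ), by
    refine (contDiff_const.mul Complex.ofRealCLM.contDiff).cexp, fun φ =>
      exp_I_mul_int_mul_add_two_pi m φ⟩

theorem expCircle_apply (m : ℤ) (φ : ℝ) :
    (expCircle m : ℝ → ℂ) φ = Complex.exp (Complex.I * m * φ) := rfl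

theorem integral_exp_I_mul_int (n : ℤ) (hn : n ≠ 0) :
    ∫ φ in (0 : ℝ)..(2 * Real.pi), Complex.exp (Complex.I * n * φ) = 0 := by
  have hc : Complex.I * (n : ℂ) ≠ 0 := mul_ne_zero Complex.I_ne_zero (by exact_mod_cast hn)
  rw [integral_exp_mul_complex hc]
  have := exp_I_mul_int_mul_add_two_pi n 0
  simp only [zero_add] at this
  rw [this]
  simp

theorem fourierC_expCircle (m n : ℤ) : fourierC (expCircle m) n = if n = m then 1 else 0 := by
  have h (φ : ℝ) : (expCircle m : ℝ → ℂ) φ * Complex.exp (-(Complex.I * n * φ))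
      = Complex.exp (Complex.I * ((m - n : ℤ) : ℂ) * φ) := by
    rw [expCircle_apply, ← Complex.exp_add]; push_cast; ring_nf
  simp only [fourierC, h]
  split_ifs with hnm
  · subst hnm
    have hpi : (Real.pi : ℂ) ≠ 0 := by exact_mod_cast Real.pi_ne_zero
    simp
    field_simp
  · rw [integral_exp_I_mul_int _ (sub_ne_zero.2 (Ne.symm hnm)), mul_zero]

/-- The Fourier series of a smooth function converges to it. -/
theorem hasSum_fourierC (f : SmoothCircle) (φ : ℝ) :
    HasSum (fun m : ℤ => fourierC f m * Complex.exp (Complex.I * m * φ)) ((f : ℝ → ℂ) φ) := by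
  have : Fact (0 < 2 * Real.pi) := ⟨Real.two_pi_pos⟩
  let F : C(AddCircle (2 * Real.pi), ℂ) :=
    ⟨f.2.2.lift, continuous_coinduced_dom.2 (continuous_circle f)⟩
  have hF (x : ℝ) : F (x : AddCircle (2 * Real.pi)) = (f : ℝ → ℂ) x := rfl
  have hpi : (Real.pi : ℂ) ≠ 0 := by exact_mod_cast Real.pi_ne_zero
  have hco (m : ℤ) : fourierCoeff F m = fourierC f m := by
    rw [fourierCoeff_eq_intervalIntegral F m 0, fourierC, zero_add, Complex.real_smul]
    congr 1
    · push_cast; rfl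
    · refine intervalIntegral.integral_congr fun x _ => ?_
      simp only [hF, fourier_coe_apply, smul_eq_mul]
      rw [mul_comm]
      congr 2
      push_cast
      field_simp
  have h := has_pointwise_sum_fourier_series_of_summable (f := F)
    (by rw [show fourierCoeff F = fourierC f from funext hco]
        exact (summable_norm_fourierC f).of_norm) (φ : AddCircle (2 * Real.pi))
  simp only [hco, hF, fourier_coe_apply, smul_eq_mul] at h
  convert h using 5 with m
  push_cast
  field_simp

theorem eq_of_fourierC_eq {f g : SmoothCircle} (h : ∀ m, fourierC f m = fourierC g m) : f = g := by
  apply Subtype.ext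
  funext φ
  have h1 := hasSum_fourierC f φ
  simp only [h] at h1
  exact h1.unique (hasSum_fourierC g φ)

theorem exists_fourierC_ne_zero {f : SmoothCircle} (hf : f ≠ 0) : ∃ m, fourierC f m ≠ 0 := by
  by_contra! h
  exact hf (eq_of_fourierC_eq fun m => by rw [h m]; exact ((fourierL m).map_zero).symm)

theorem norm_le_tsum_norm_fourierC (f : SmoothCircle) (φ : ℝ) :
    ‖(f : ℝ → ℂ) φ‖ ≤ ∑' m, ‖fourierC f m‖ := by
  have hn (m : ℤ) : ‖fourierC f m * Complex.exp (Complex.I * m * φ)‖ = ‖fourierC f m‖ := by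
    rw [norm_mul, norm_exp_I_mul_int_mul, mul_one]
  rw [← (hasSum_fourierC f φ).tsum_eq]
  simp only [← hn]
  exact norm_tsum_le_tsum_norm (by simpa only [hn] using summable_norm_fourierC f)

theorem derivCircle_sub (f g : SmoothCircle) :
    derivCircle (f - g) = derivCircle f - derivCircle g :=
  eq_of_fourierC_eq fun m => by simp only [fourierC_derivCircle, fourierC_sub, mul_sub]

/-- If the Fourier coefficients of the `u n` converge and are dominated by those of one smooth
function, then `u n` converges with all derivatives. -/
theorem mem_of_dominated {W : Submodule ℂ SmoothCircle} (hW : IsSmoothClosed W)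
    {u : ℕ → SmoothCircle} {f g : SmoothCircle} (hu : ∀ n, u n ∈ W)
    (hlim : ∀ m, Tendsto (fun n => fourierC (u n) m) atTop (𝓝 (fourierC f m)))
    (hdom : ∀ n m, ‖fourierC (u n) m‖ ≤ ‖fourierC g m‖) : f ∈ W := by
  refine hW u f hu fun k => ?_
  have hdomf (m : ℤ) : ‖fourierC f m‖ ≤ ‖fourierC g m‖ :=
    le_of_tendsto (hlim m).norm (Eventually.of_forall fun n => hdom n m)
  have hsum (n : ℕ) (m : ℤ) : ‖|(m : ℝ)| ^ k * ‖fourierC (u n - f) m‖‖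
      ≤ 2 * (|(m : ℝ)| ^ k * ‖fourierC g m‖) := by
    rw [Real.norm_of_nonneg (by positivity), fourierC_sub]
    have := norm_sub_le (fourierC (u n) m) (fourierC f m)
    calc _ ≤ |(m : ℝ)| ^ k * (‖fourierC g m‖ + ‖fourierC g m‖) := by
          gcongr; exact this.trans (add_le_add (hdom n m) (hdomf m))
      _ = _ := by ring
  have hto : Tendsto (fun n => ∑' m : ℤ, |(m : ℝ)| ^ k * ‖fourierC (u n - f) m‖) atTop (𝓝 0) := by
    have := tendsto_tsum_of_dominated_convergence
      (f := fun n (m : ℤ) => |(m : ℝ)| ^ k * ‖fourierC (u n - f) m‖) (g := fun _ => 0)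
      (𝓕 := atTop) ((summable_pow_mul_norm_fourierC g k).mul_left 2) (fun m => by
        have h := ((hlim m).sub_const (fourierC f m)).norm.const_mul (|(m : ℝ)| ^ k)
        simpa only [fourierC_sub, sub_self, norm_zero, mul_zero] using h)
      (Eventually.of_forall hsum)
    simpa using this
  rw [Metric.tendstoUniformly_iff]
  intro ε hε
  filter_upwards [hto.eventually (gt_mem_nhds hε)] with n hn φ
  have hD : ∀ k, derivCircle^[k] (u n - f) = derivCircle^[k] (u n) - derivCircle^[k] f := by
    intro k
    induction k with
    | zero => rfl
    | succ k ih => simp only [Function.iterate_succ_apply', ih, derivCircle_sub]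
  rw [dist_comm, dist_eq_norm, ← coe_iterate_derivCircle, ← coe_iterate_derivCircle,
    ← Pi.sub_apply, ← Submodule.coe_sub, ← hD]
  refine lt_of_le_of_lt (norm_le_tsum_norm_fourierC _ φ) ?_
  simpa only [norm_fourierC_iterate_derivCircle] using hn

/-- A closed subspace containing all exponentials is the whole space. -/
theorem eq_top_of_expCircle_mem {W : Submodule ℂ SmoothCircle} (hW : IsSmoothClosed W)
    (he : ∀ m, expCircle m ∈ W) : W = ⊤ := by
  rw [eq_top_iff]
  intro f _
  have hc (n : ℕ) (m : ℤ) :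
      fourierC (∑ j ∈ Finset.Icc (-(n : ℤ)) n, fourierC f j • expCircle j) m =
        if m ∈ Finset.Icc (-(n : ℤ)) n then fourierC f m else 0 := by
    simp only [fourierC_sum, fourierC_smul, fourierC_expCircle, mul_ite, mul_one, mul_zero,
      Finset.sum_ite_eq]
  refine mem_of_dominated hW (u := fun n : ℕ => ∑ j ∈ Finset.Icc (-(n : ℤ)) n,
    fourierC f j • expCircle j) (g := f)
    (fun n => W.sum_mem fun j _ => W.smul_mem _ (he j)) (fun m => ?_) (fun n m => ?_)
  · refine tendsto_const_nhds.congr' ?_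
    filter_upwards [eventually_ge_atTop m.natAbs] with n hn
    rw [hc, if_pos]
    rw [Finset.mem_Icc]
    omega
  · rw [hc]
    split_ifs
    · rfl
    · simp

/-! ### The weights `Φ_m` -/

/-- The weights `Φ_n / Φ_0`, `n ≥ 0`, as rational functions of the parameter. -/
noncomputable def weightC (z : ℂ) (n : ℕ) : ℂ :=
  ∏ j ∈ Finset.range n, ((j : ℂ) + 1 + z) / ((j : ℂ) - z)

/-- The normalized weights `Φ_m / Φ_0`, for non-integer `σ`; they are even in `m`. -/
noncomputable def weight (σ : ℝ) (m : ℤ) : ℝ :=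
  ∏ j ∈ Finset.range m.natAbs, ((j : ℝ) + 1 + σ) / ((j : ℝ) - σ)

theorem ofReal_weight (σ : ℝ) (m : ℤ) : (weight σ m : ℂ) = weightC σ m.natAbs := by
  simp [weight, weightC]

theorem weight_zero (σ : ℝ) : weight σ 0 = 1 := by simp [weight]

theorem weight_one (σ : ℝ) : weight σ 1 = (1 + σ) / (-σ) := by simp [weight]

theorem ne_int_of_mem_strip {σ : ℝ} (h1 : -1 < σ) (h0 : σ < 0) (n : ℤ) : σ ≠ n := by
  rintro rfl
  have a : (-1 : ℤ) < n := by exact_mod_cast h1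
  have b : n < 0 := by exact_mod_cast h0
  omega

theorem weight_succ {σ : ℝ} (hσ : ∀ n : ℤ, σ ≠ n) (m : ℤ) :
    weight σ (m + 1) * (m - σ) = weight σ m * (m + 1 + σ) := by
  obtain ⟨n, rfl | rfl⟩ : ∃ n : ℕ, m = n ∨ m = -((n : ℤ) + 1) := by
    obtain ⟨n, h | h⟩ := m.eq_nat_or_neg
    · exact ⟨n, Or.inl h⟩
    · rcases n with _ | n
      · exact ⟨0, Or.inl (by simpa using h)⟩
      · exact ⟨n, Or.inr (by simpa using h)⟩
  · have hn : ((n : ℝ) - σ) ≠ 0 := sub_ne_zero.2 fun h => hσ n (by simpa using h.symm)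
    have e1 : ((n : ℤ) + 1).natAbs = n + 1 := by omega
    have e2 : ((n : ℤ)).natAbs = n := by omega
    rw [weight, weight, e1, e2, Finset.prod_range_succ]
    push_cast
    field_simp
  · have hn : ((n : ℝ) - σ) ≠ 0 := sub_ne_zero.2 fun h => hσ n (by simpa using h.symm)
    have e1 : (-((n : ℤ) + 1) + 1).natAbs = n := by omega
    have e2 : (-((n : ℤ) + 1)).natAbs = n + 1 := by omega
    rw [weight, weight, e1, e2, Finset.prod_range_succ]
    push_cast
    field_simp
    ring

theorem Phi_succ {σ : ℝ} (hσ : ∀ n : ℤ, σ ≠ n) (m : ℤ) :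
    Phi σ (m + 1) * (m - σ) = Phi σ m * (m + 1 + σ) := by
  have h1 : (m : ℝ) + σ + 1 ≠ 0 := fun h => hσ (-(m + 1)) (by push_cast; linarith)
  have h2 : (m : ℝ) - σ ≠ 0 := fun h => hσ m (by linarith)
  have hG : Real.Gamma (m - σ) ≠ 0 := Real.Gamma_ne_zero fun k hk =>
    hσ (m + k) (by push_cast; linarith)
  have e1 : ((m + 1 : ℤ) : ℝ) + σ + 1 = ((m : ℝ) + σ + 1) + 1 := by push_cast; ring
  have e2 : ((m + 1 : ℤ) : ℝ) - σ = ((m : ℝ) - σ) + 1 := by push_cast; ring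
  rw [Phi, Phi, e1, e2, Real.Gamma_add_one h1, Real.Gamma_add_one h2]
  field_simp
  ring

/-- The recurrence determines a sequence up to a factor. -/
theorem eq_mul_weight {σ : ℝ} (hσ : ∀ n : ℤ, σ ≠ n) {K : ℤ → ℂ}
    (hK : ∀ m : ℤ, K (m + 1) * (m - σ) = K m * (m + 1 + σ)) (m : ℤ) :
    K m = K 0 * weight σ m := by
  have h2 (m : ℤ) : (m : ℂ) - σ ≠ 0 := fun h => hσ m (by exact_mod_cast (sub_eq_zero.1 h).symm)
  have h1 (m : ℤ) : (m : ℂ) + 1 + σ ≠ 0 := fun h => hσ (-(m + 1)) (by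
    have h' : (σ : ℂ) = ((-(m + 1) : ℤ) : ℝ) := by push_cast; linear_combination h
    exact_mod_cast h')
  have hw (m : ℤ) : (weight σ (m + 1) : ℂ) * (m - σ) = weight σ m * (m + 1 + σ) := by
    exact_mod_cast weight_succ hσ m
  induction m using Int.induction_on with
  | zero => simp [weight_zero]
  | succ n ih =>
    apply mul_right_cancel₀ (h2 n)
    rw [hK, ih, mul_assoc, mul_assoc, hw]
  | pred n ih =>
    have ep := hK (-(n : ℤ) - 1)
    have ew := hw (-(n : ℤ) - 1)
    apply mul_right_cancel₀ (h1 (-(n : ℤ) - 1))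
    rw [mul_assoc, ← ep, ← ew, sub_add_cancel, ih]
    ring

theorem Phi_eq {σ : ℝ} (hσ : ∀ n : ℤ, σ ≠ n) (m : ℤ) :
    Phi σ m = Real.Gamma (σ + 1) / Real.Gamma (-σ) * weight σ m := by
  have h := eq_mul_weight hσ (K := fun m => (Phi σ m : ℂ))
    (fun m => by exact_mod_cast Phi_succ hσ m) m
  have h0 : Phi σ 0 = Real.Gamma (σ + 1) / Real.Gamma (-σ) := by simp [Phi]
  rw [← h0]
  exact_mod_cast h

theorem weight_pos {σ : ℝ} (h1 : -1 < σ) (h0 : σ < 0) (m : ℤ) : 0 < weight σ m := by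
  refine Finset.prod_pos fun j _ => div_pos ?_ ?_
  · have : (0 : ℝ) ≤ j := j.cast_nonneg
    linarith
  · have : (0 : ℝ) ≤ j := j.cast_nonneg
    linarith

/-- For `-1 < re z < 0` one has `|n + 1 + z| / |n - z| ≤ (n + 1) / n`, so that the weights grow at
most linearly. -/
theorem norm_weightC_succ_le {z : ℂ} (h1 : -1 < z.re) (h0 : z.re < 0) (n : ℕ) :
    ‖weightC z (n + 1)‖ ≤ (n + 1) * ‖(1 + z) / z‖ := by
  induction n with
  | zero => simp [weightC]
  | succ n ih =>
    have hn : (0 : ℝ) ≤ n := n.cast_nonneg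
    have hden : 0 < ‖((n + 1 : ℕ) : ℂ) - z‖ := by
      rw [norm_pos_iff]
      intro h
      have := congrArg Complex.re h
      simp at this
      linarith
    have hratio : ‖(((n + 1 : ℕ) : ℂ) + 1 + z) / (((n + 1 : ℕ) : ℂ) - z)‖ ≤ (n + 2) / (n + 1) := by
      rw [norm_div, div_le_div_iff₀ hden (by positivity)]
      refine abs_le_of_sq_le_sq' ?_ (by positivity) |>.2
      rw [mul_pow, mul_pow, Complex.sq_norm, Complex.sq_norm, Complex.normSq_apply,
        Complex.normSq_apply]
      simp
      have a : ((n : ℝ) + 1 + 1 + z.re) ^ 2 * (n + 1) ^ 2 ≤ (n + 2) ^ 2 * (n + 1 - z.re) ^ 2 := by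
        rw [← mul_pow, ← mul_pow]
        apply pow_le_pow_left₀
        · apply mul_nonneg <;> linarith
        · nlinarith
      nlinarith [sq_nonneg z.im]
    rw [weightC, Finset.prod_range_succ, ← weightC, norm_mul]
    calc ‖weightC z (n + 1)‖ * _ ≤ ((n + 1) * ‖(1 + z) / z‖) * ((n + 2) / (n + 1)) := by gcongr
      _ = _ := by push_cast; field_simp; ring

theorem norm_weightC_le {z : ℂ} (h1 : -1 < z.re) (h0 : z.re < 0) (m : ℤ) :
    ‖weightC z m.natAbs‖ ≤ (1 + ‖(1 + z) / z‖) * (1 + (m : ℝ) ^ 2) := by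
  have hm : ((m.natAbs : ℕ) : ℝ) ^ 2 = (m : ℝ) ^ 2 := by
    rw [Nat.cast_natAbs]; push_cast; exact sq_abs _
  rw [← hm]
  rcases m.natAbs with _ | n
  · simp only [weightC, Finset.range_zero, Finset.prod_empty, norm_one, Nat.cast_zero]
    have := norm_nonneg ((1 + z) / z)
    linarith
  · refine (norm_weightC_succ_le h1 h0 n).trans ?_
    push_cast
    have hn : (0 : ℝ) ≤ n := n.cast_nonneg
    have := norm_nonneg ((1 + z) / z)
    calc _ ≤ (1 + ((n : ℝ) + 1) ^ 2) * ‖(1 + z) / z‖ :=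
          mul_le_mul_of_nonneg_right (by nlinarith) this
      _ ≤ _ := by nlinarith [sq_nonneg ((n : ℝ) + 1)]

theorem weight_le {σ : ℝ} (h1 : -1 < σ) (h0 : σ < 0) :
    ∃ C, ∀ m : ℤ, weight σ m ≤ C * (1 + (m : ℝ) ^ 2) := by
  refine ⟨1 + ‖(1 + (σ : ℂ)) / σ‖, fun m => ?_⟩
  have := norm_weightC_le (z := (σ : ℂ)) (by simpa using h1) (by simpa using h0) m
  rw [← ofReal_weight, Complex.norm_real] at this
  exact (le_abs_self _).trans this

/-- The diagonal form with the weights `Φ_m / Φ_0`. -/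
noncomputable def weightForm (σ : ℝ) (f₁ f₂ : SmoothCircle) : ℂ :=
  ∑' m : ℤ, (weight σ m : ℂ) * conj (fourierC f₁ m) * fourierC f₂ m

/-- The normalization of the form in terms of the weights `Φ_m / Φ_0`. -/
noncomputable def formConst (c₀ σ : ℝ) : ℝ :=
  c₀ * 2 ^ (-σ - 1) / (Real.sqrt Real.pi * Real.Gamma (-σ))

theorem Gamma_succ_ne_zero {σ : ℝ} (hσ : ∀ n : ℤ, σ ≠ n) : Real.Gamma (σ + 1) ≠ 0 :=
  Real.Gamma_ne_zero fun k hk => hσ (-(k + 1)) (by push_cast; linarith)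

theorem diagForm_eq {σ : ℝ} (hσ : ∀ n : ℤ, σ ≠ n) (c₀ : ℝ) (f₁ f₂ : SmoothCircle) :
    diagForm c₀ σ f₁ f₂ = (formConst c₀ σ : ℂ) * weightForm σ f₁ f₂ := by
  have hG := Gamma_succ_ne_zero hσ
  have hterm (m : ℤ) : (Phi σ m : ℂ) * conj (fourierC f₁ m) * fourierC f₂ m =
      ((Real.Gamma (σ + 1) / Real.Gamma (-σ) : ℝ) : ℂ) *
        ((weight σ m : ℂ) * conj (fourierC f₁ m) * fourierC f₂ m) := by
    rw [Phi_eq hσ]; push_cast; ring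
  rw [diagForm, weightForm]
  simp only [hterm]
  rw [tsum_mul_left, ← mul_assoc, ← Complex.ofReal_mul]
  congr 2
  rw [formConst]
  field_simp

theorem formConst_pos {c₀ σ : ℝ} (hc : 0 < c₀) (h0 : σ < 0) : 0 < formConst c₀ σ := by
  have := Real.Gamma_pos_of_pos (s := -σ) (by linarith)
  have := Real.pi_pos
  unfold formConst
  positivity

theorem exists_weight_mul_norm_fourierC_le {σ : ℝ} (h1 : -1 < σ) (h0 : σ < 0) (f : SmoothCircle) :
    ∃ C, ∀ m, weight σ m * ‖fourierC f m‖ ≤ C := by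
  obtain ⟨C, hC⟩ := weight_le h1 h0
  obtain ⟨D, hD⟩ := exists_norm_fourierC_le_div f
  refine ⟨C * D, fun m => ?_⟩
  have hw := weight_pos h1 h0 m
  have hp : 0 < 1 + (m : ℝ) ^ 2 := by positivity
  calc _ ≤ (C * (1 + (m : ℝ) ^ 2)) * (D * (1 + (m : ℝ) ^ 2)⁻¹) :=
        mul_le_mul (hC m) (hD m) (norm_nonneg _) (hw.le.trans (hC m))
    _ = C * D := by field_simp

theorem summable_weight_mul {σ : ℝ} (h1 : -1 < σ) (h0 : σ < 0) (f₁ f₂ : SmoothCircle) :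
    Summable fun m : ℤ => (weight σ m : ℂ) * conj (fourierC f₁ m) * fourierC f₂ m := by
  obtain ⟨C, hC⟩ := exists_weight_mul_norm_fourierC_le h1 h0 f₁
  refine Summable.of_norm_bounded ((summable_norm_fourierC f₂).mul_left C) fun m => ?_
  rw [norm_mul, norm_mul, Complex.norm_real, Real.norm_of_nonneg (weight_pos h1 h0 m).le,
    RCLike.norm_conj]
  exact mul_le_mul_of_nonneg_right (hC m) (norm_nonneg _)

theorem summable_Phi_mul {σ : ℝ} (h1 : -1 < σ) (h0 : σ < 0) (f₁ f₂ : SmoothCircle) :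
    Summable fun m : ℤ => (Phi σ m : ℂ) * conj (fourierC f₁ m) * fourierC f₂ m := by
  have h := (summable_weight_mul h1 h0 f₁ f₂).mul_left
    ((Real.Gamma (σ + 1) / Real.Gamma (-σ) : ℝ) : ℂ)
  refine h.congr fun m => ?_
  rw [Phi_eq (ne_int_of_mem_strip h1 h0)]; push_cast; ring

theorem isScalarProduct_diagForm {c₀ σ : ℝ} (h1 : -1 < σ) (h0 : σ < 0) (hc : 0 < c₀) :
    IsScalarProduct (diagForm c₀ σ) := by
  have hσ := ne_int_of_mem_strip h1 h0
  have hA := formConst_pos hc h0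
  constructor
  · intro u v w
    simp only [diagForm_eq hσ, weightForm, fourierC_add, mul_add]
    rw [(summable_weight_mul h1 h0 u v).tsum_add (summable_weight_mul h1 h0 u w), mul_add]
  · intro c u v
    simp only [diagForm_eq hσ, weightForm, fourierC_smul, mul_left_comm _ c]
    rw [tsum_mul_left]
    ring
  · intro u v
    simp only [diagForm_eq hσ, weightForm, map_mul, Complex.conj_ofReal, Complex.conj_tsum,
      Complex.conj_conj]
    congr 1
    exact tsum_congr fun m => by ring
  · intro u hu
    obtain ⟨m, hm⟩ := exists_fourierC_ne_zero hu
    have hterm (m : ℤ) : (weight σ m : ℂ) * conj (fourierC u m) * fourierC u m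
        = ((weight σ m * ‖fourierC u m‖ ^ 2 : ℝ) : ℂ) := by
      rw [mul_assoc, Complex.conj_mul']; push_cast; rfl
    have hs := summable_weight_mul h1 h0 u u
    simp only [hterm] at hs
    rw [diagForm_eq hσ, weightForm]
    simp only [hterm]
    rw [← Complex.ofReal_tsum, ← Complex.ofReal_mul, Complex.ofReal_re]
    refine mul_pos hA ((Complex.summable_ofReal.1 hs).tsum_pos
      (fun m => mul_nonneg (weight_pos h1 h0 m).le (by positivity)) m ?_)
    have := weight_pos h1 h0 m
    have := norm_pos_iff.2 hm
    positivity

/-! ### Positivity fails outside the strip -/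

theorem tsum_fourierC_expCircle (p : ℤ → ℂ) (n : ℤ) :
    ∑' m : ℤ, p m * conj (fourierC (expCircle n) m) * fourierC (expCircle n) m = p n := by
  rw [tsum_eq_single n]
  · simp [fourierC_expCircle]
  · intro m hm
    simp [fourierC_expCircle, hm]

/-- The recurrence for the weights, as a relation between the squared lengths of `1` and
`e^{iφ}`. -/
theorem diagForm_expCircle_one {σ : ℝ} (hσ : ∀ n : ℤ, σ ≠ n) (c₀ : ℝ) :
    (diagForm c₀ σ (expCircle 1) (expCircle 1)) * ((-σ : ℝ) : ℂ) =
      (diagForm c₀ σ (expCircle 0) (expCircle 0)) * ((σ + 1 : ℝ) : ℂ) := by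
  have hσ0 : (σ : ℂ) ≠ 0 := by
    have := hσ 0
    simpa using this
  rw [diagForm_eq hσ, diagForm_eq hσ, weightForm, weightForm,
    tsum_fourierC_expCircle (fun m => (weight σ m : ℂ)),
    tsum_fourierC_expCircle (fun m => (weight σ m : ℂ)), weight_zero, weight_one]
  push_cast
  field_simp
  ring

theorem expCircle_ne_zero (n : ℤ) : expCircle n ≠ 0 := by
  intro h
  have := fourierC_expCircle n n
  rw [h, if_pos rfl, ← fourierL_apply, map_zero] at this
  exact zero_ne_one this

theorem isScalarProduct_diagForm_iff {σ : ℝ} (hσ : ∀ n : ℤ, σ ≠ n) (c₀ : ℝ) :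
    IsScalarProduct (diagForm c₀ σ) ↔ (-1 < σ ∧ σ < 0) ∧ 0 < c₀ := by
  refine ⟨fun h => ?_, fun h => isScalarProduct_diagForm h.1.1 h.1.2 h.2⟩
  have p0 := h.pos _ (expCircle_ne_zero 0)
  have p1 := h.pos _ (expCircle_ne_zero 1)
  have hr := congrArg Complex.re (diagForm_expCircle_one hσ c₀)
  rw [Complex.re_mul_ofReal, Complex.re_mul_ofReal] at hr
  have hσ1 : -1 < σ ∧ σ < 0 := by
    have n0 : σ ≠ 0 := by simpa using hσ 0
    have n1 : σ ≠ -1 := by simpa using hσ (-1)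
    rcases lt_or_gt_of_ne n0 with h' | h'
    · refine ⟨?_, h'⟩
      by_contra hle
      have : σ < -1 := lt_of_le_of_ne (not_lt.1 hle) n1
      nlinarith
    · nlinarith
  refine ⟨hσ1, ?_⟩
  rw [diagForm_eq hσ, weightForm, tsum_fourierC_expCircle (fun m => (weight σ m : ℂ)),
    weight_zero, Complex.ofReal_one, mul_one, Complex.ofReal_re, formConst] at p0
  have hG := Real.Gamma_pos_of_pos (s := -σ) (by linarith)
  have hpi := Real.sqrt_pos.2 Real.pi_pos
  have h2 : (0 : ℝ) < 2 ^ (-σ - 1) := by positivity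
  have := (div_pos_iff_of_pos_right (mul_pos hpi hG)).1 p0
  exact (mul_pos_iff_of_pos_right h2).1 this

theorem not_isScalarProduct_limit (n : ℤ) (c : ℝ → ℝ) (B : SmoothCircle → SmoothCircle → ℂ)
    (hB : ∀ f₁ f₂ : SmoothCircle,
      Tendsto (fun s : ℝ => diagForm (c s) s f₁ f₂) (𝓝[≠] (n : ℝ)) (𝓝 (B f₁ f₂))) :
    ¬ IsScalarProduct B := by
  intro h
  have p0 := h.pos _ (expCircle_ne_zero 0)
  have p1 := h.pos _ (expCircle_ne_zero 1)
  -- real numbers close to `n` and different from `n` are not integers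
  have hev : ∀ᶠ s : ℝ in 𝓝[≠] (n : ℝ), ∀ k : ℤ, s ≠ k := by
    have hball : Ioo ((n : ℝ) - 1) (n + 1) ∈ 𝓝 (n : ℝ) := Ioo_mem_nhds (by linarith) (by linarith)
    filter_upwards [nhdsWithin_le_nhds hball, self_mem_nhdsWithin] with s hs hne k hk
    rw [hk] at hs hne
    have h1 : n - 1 < k := by exact_mod_cast hs.1
    have h2 : k < n + 1 := by exact_mod_cast hs.2
    exact hne (by rw [show k = n by omega]; rfl)
  have hid : Tendsto (fun s : ℝ => s) (𝓝[≠] (n : ℝ)) (𝓝 (n : ℝ)) := nhdsWithin_le_nhds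
  have hl := (hB (expCircle 1) (expCircle 1)).mul
    ((Complex.continuous_ofReal.tendsto _).comp hid.neg)
  have hr := (hB (expCircle 0) (expCircle 0)).mul
    ((Complex.continuous_ofReal.tendsto _).comp (hid.add_const 1))
  have he := tendsto_nhds_unique (hl.congr' (hev.mono fun s hs => diagForm_expCircle_one hs (c s)))
    hr
  have hre := congrArg Complex.re he
  rw [Complex.re_mul_ofReal, Complex.re_mul_ofReal] at hre
  rcases lt_trichotomy n (-1) with hn | hn | hn
  · have : (n : ℝ) < -1 := by exact_mod_cast hn
    nlinarith
  · rw [hn] at hre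
    norm_num at hre
    linarith
  · have : (0 : ℝ) ≤ n := by exact_mod_cast (by omega : 0 ≤ n)
    nlinarith

/-! ### The generator of boosts -/

theorem contDiffAt_coneExt (σ : ℝ) (f : SmoothCircle) {k : Fin 3 → ℝ} (hq : quad k = 0)
    (h0 : 0 < k 0) : ContDiffAt ℝ ∞ (coneExt σ f) k := by
  have happ (i : Fin 3) : ContDiff ℝ ∞ fun k : Fin 3 → ℝ => k i := contDiff_apply ℝ ℝ i
  refine ContDiffAt.mul ?_ ?_
  · exact Complex.ofRealCLM.contDiff.contDiffAt.comp k
      ((happ 0).contDiffAt.rpow_const_of_ne h0.ne')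
  · have hz : (⟨k 2, k 1⟩ : ℂ) ≠ 0 := by
      intro h
      have hre := congrArg Complex.re h
      have him := congrArg Complex.im h
      simp only [Complex.zero_re, Complex.zero_im] at hre him
      unfold quad at hq
      rw [hre, him] at hq
      nlinarith
    have hmk : ContDiff ℝ ∞ fun k : Fin 3 → ℝ => (⟨k 2, k 1⟩ : ℂ) := by
      have h := (Complex.ofRealCLM.contDiff.comp (happ 2)).add
        ((Complex.ofRealCLM.contDiff.comp (happ 1)).mul (contDiff_const (c := Complex.I)))
      convert h using 1
      funext x
      apply Complex.ext <;> simp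
    exact ContDiffAt.comp k (g := fun w : ℂ => (f : ℝ → ℂ) (Complex.arg w))
      (contDiff_comp_arg f.2.1 f.2.2 hz) hmk.contDiffAt

/-- A smooth one-parameter family of functions on the circle. -/
def IsSmoothFamily (u : ℝ → SmoothCircle) : Prop :=
  ContDiff ℝ ∞ fun p : ℝ × ℝ => (u p.1 : ℝ → ℂ) p.2

theorem isSmoothFamily_boost (σ : ℝ) (f : SmoothCircle) :
    IsSmoothFamily fun α => rep σ (boost α) f := by
  unfold IsSmoothFamily
  simp only [rep_apply]
  rw [contDiff_iff_contDiffAt]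
  intro p
  refine ContDiffAt.comp p (g := coneExt σ f)
    (f := fun p : ℝ × ℝ => mat (boost p.1)⁻¹ *ᵥ conePoint p.2)
    (contDiffAt_coneExt σ f (by rw [quad_mat, quad_conePoint]) (mat_conePoint_pos _ _)) ?_
  simp only [mat_boost_inv, boostMat_neg_mulVec]
  refine ContDiff.contDiffAt (contDiff_pi.2 fun i => ?_)
  have h1 : ContDiff ℝ ∞ fun p : ℝ × ℝ => Real.cosh p.1 := Real.contDiff_cosh.comp contDiff_fst
  have h2 : ContDiff ℝ ∞ fun p : ℝ × ℝ => Real.sinh p.1 := Real.contDiff_sinh.comp contDiff_fst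
  have h3 : ContDiff ℝ ∞ fun p : ℝ × ℝ => Real.cos p.2 := Real.contDiff_cos.comp contDiff_snd
  have h4 : ContDiff ℝ ∞ fun p : ℝ × ℝ => Real.sin p.2 := Real.contDiff_sin.comp contDiff_snd
  fin_cases i
  · exact h1.sub (h2.mul h3)
  · exact h4
  · exact h2.neg.add (h1.mul h3)

theorem IsSmoothFamily.derivCircle {u : ℝ → SmoothCircle} (hu : IsSmoothFamily u) :
    IsSmoothFamily fun α => derivCircle (u α) := by
  have h : ContDiff ℝ ∞ fun p : ℝ × ℝ => fderiv ℝ (u p.1 : ℝ → ℂ) p.2 :=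
    ContDiff.fderiv (f := fun (p : ℝ × ℝ) (x : ℝ) => (u p.1 : ℝ → ℂ) x) (g := fun p => p.2)
      (ContDiff.comp (g := fun p : ℝ × ℝ => (u p.1 : ℝ → ℂ) p.2)
        (f := fun q : (ℝ × ℝ) × ℝ => (q.1.1, q.2)) hu
        ((contDiff_fst.comp contDiff_fst).prodMk contDiff_snd)) contDiff_snd (m := ∞) (by simp)
  exact h.clm_apply contDiff_const

theorem IsSmoothFamily.exists_bound {u : ℝ → SmoothCircle} (hu : IsSmoothFamily u) (R : ℝ) :
    ∃ C, ∀ α ∈ Icc (-R) R, ∀ φ, ‖(u α : ℝ → ℂ) φ‖ ≤ C := by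
  obtain ⟨C, hC⟩ := ((isCompact_Icc (a := -R) (b := R)).prod
    (isCompact_Icc (a := (0 : ℝ)) (b := 2 * Real.pi))).exists_bound_of_continuousOn
    hu.continuous.continuousOn
  refine ⟨C, fun α hα φ => ?_⟩
  obtain ⟨y, hy, hxy⟩ := (u α).2.2.exists_mem_Ico₀ Real.two_pi_pos φ
  rw [hxy]
  exact hC (α, y) ⟨hα, hy.1, hy.2.le⟩

theorem IsSmoothFamily.exists_norm_fourierC_le {u : ℝ → SmoothCircle} (hu : IsSmoothFamily u)
    (R : ℝ) : ∃ C, ∀ α ∈ Icc (-R) R, ∀ m, ‖fourierC (u α) m‖ ≤ C * (1 + (m : ℝ) ^ 2)⁻¹ := by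
  obtain ⟨C₀, h0⟩ := hu.exists_bound R
  obtain ⟨C₂, h2⟩ := hu.derivCircle.derivCircle.exists_bound R
  exact ⟨2 * max C₀ C₂, fun α hα m => norm_fourierC_le_div (u α)
    (fun φ => (h0 α hα φ).trans (le_max_left _ _))
    (fun φ => (h2 α hα φ).trans (le_max_right _ _)) m⟩

/-- The generator `f ↦ sin φ f' - σ cos φ f` of the boosts `T_σ(h(α))`. -/
noncomputable def boostGen (σ : ℝ) (f : SmoothCircle) : SmoothCircle :=
  ⟨fun φ => (Real.sin φ : ℂ) * (derivCircle f : ℝ → ℂ) φ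
      - (σ : ℂ) * (Real.cos φ : ℂ) * (f : ℝ → ℂ) φ, by
    have h1 : ContDiff ℝ ∞ fun φ : ℝ => (Real.sin φ : ℂ) :=
      Complex.ofRealCLM.contDiff.comp Real.contDiff_sin
    have h2 : ContDiff ℝ ∞ fun φ : ℝ => (Real.cos φ : ℂ) :=
      Complex.ofRealCLM.contDiff.comp Real.contDiff_cos
    exact (h1.mul (derivCircle f).2.1).sub ((contDiff_const.mul h2).mul f.2.1), fun φ => by
    simp only [Real.sin_add_two_pi, Real.cos_add_two_pi, (derivCircle f).2.2 φ, f.2.2 φ]⟩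

theorem boostGen_apply (σ : ℝ) (f : SmoothCircle) (φ : ℝ) : (boostGen σ f : ℝ → ℂ) φ =
    (Real.sin φ : ℂ) * (derivCircle f : ℝ → ℂ) φ - (σ : ℂ) * (Real.cos φ : ℂ) * (f : ℝ → ℂ) φ := rfl

theorem IsSmoothFamily.boostGen {u : ℝ → SmoothCircle} (hu : IsSmoothFamily u) (σ : ℝ) :
    IsSmoothFamily fun α => boostGen σ (u α) := by
  have h1 : ContDiff ℝ ∞ fun p : ℝ × ℝ => (Real.sin p.2 : ℂ) :=
    Complex.ofRealCLM.contDiff.comp (Real.contDiff_sin.comp contDiff_snd)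
  have h2 : ContDiff ℝ ∞ fun p : ℝ × ℝ => (Real.cos p.2 : ℂ) :=
    Complex.ofRealCLM.contDiff.comp (Real.contDiff_cos.comp contDiff_snd)
  exact (h1.mul hu.derivCircle).sub ((contDiff_const.mul h2).mul hu)

/-- In Fourier coefficients the generator is a two-term difference operator. -/
theorem fourierC_boostGen (σ : ℝ) (f : SmoothCircle) (m : ℤ) :
    fourierC (boostGen σ f) m =
      ((m - 1 - σ) * fourierC f (m - 1) - (m + 1 + σ) * fourierC f (m + 1)) / 2 := by
  have key (φ : ℝ) : (boostGen σ f : ℝ → ℂ) φ * Complex.exp (-(Complex.I * m * φ)) =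
      (-(Complex.I / 2) * ((derivCircle f : ℝ → ℂ) φ *
          Complex.exp (-(Complex.I * (m - 1 : ℤ) * φ))) +
        (Complex.I / 2) * ((derivCircle f : ℝ → ℂ) φ *
          Complex.exp (-(Complex.I * (m + 1 : ℤ) * φ)))) +
      (-((σ : ℂ) / 2) * ((f : ℝ → ℂ) φ * Complex.exp (-(Complex.I * (m - 1 : ℤ) * φ))) +
        -((σ : ℂ) / 2) * ((f : ℝ → ℂ) φ * Complex.exp (-(Complex.I * (m + 1 : ℤ) * φ)))) := by
    have e1 : Complex.exp (-(Complex.I * (m - 1 : ℤ) * φ)) =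
        Complex.exp (-(Complex.I * m * φ)) * Complex.exp (φ * Complex.I) := by
      rw [← Complex.exp_add]; push_cast; ring_nf
    have e2 : Complex.exp (-(Complex.I * (m + 1 : ℤ) * φ)) =
        Complex.exp (-(Complex.I * m * φ)) * Complex.exp (-φ * Complex.I) := by
      rw [← Complex.exp_add]; push_cast; ring_nf
    rw [boostGen_apply, e1, e2, Complex.ofReal_sin, Complex.ofReal_cos, Complex.sin, Complex.cos]
    ring
  have i1 (f : SmoothCircle) (n : ℤ) (c : ℂ) : IntervalIntegrable (fun φ : ℝ =>
      c * ((f : ℝ → ℂ) φ * Complex.exp (-(Complex.I * n * φ)))) volume 0 (2 * Real.pi) :=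
    (intervalIntegrable_mul_exp (continuous_circle f) n _ _).const_mul c
  have d1 := fourierC_derivCircle f (m - 1)
  have d2 := fourierC_derivCircle f (m + 1)
  simp only [fourierC, key] at d1 d2 ⊢
  rw [intervalIntegral.integral_add ((i1 _ _ _).add (i1 _ _ _)) ((i1 _ _ _).add (i1 _ _ _)),
    intervalIntegral.integral_add (i1 _ _ _) (i1 _ _ _),
    intervalIntegral.integral_add (i1 _ _ _) (i1 _ _ _)]
  simp only [intervalIntegral.integral_const_mul]
  push_cast at d1 d2 ⊢
  linear_combination (-(Complex.I / 2)) * d1 + (Complex.I / 2) * d2 +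
    ((∫ φ in (0 : ℝ)..(2 * Real.pi), (f : ℝ → ℂ) φ * Complex.exp (-(Complex.I * (m - 1) * φ))) *
      (1 / (2 * Real.pi)) * (-(1 / 2)) * (m - 1) +
     (∫ φ in (0 : ℝ)..(2 * Real.pi), (f : ℝ → ℂ) φ * Complex.exp (-(Complex.I * (m + 1) * φ))) *
      (1 / (2 * Real.pi)) * (1 / 2) * (m + 1)) * Complex.I_mul_I

theorem boost_zero : boost 0 = 1 := Subtype.ext boostO_zero

theorem boost_add (α β : ℝ) : boost (α + β) = boost α * boost β := by
  apply mat_injective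
  rw [mat_mul, mat_boost, mat_boost, mat_boost]
  ext i j
  fin_cases i <;> fin_cases j <;>
    simp [boostMat, Matrix.mul_apply, Fin.sum_univ_three, Real.cosh_add, Real.sinh_add] <;> ring

/-- The boosted function, with the new angle as a smooth function of `α` near `α = 0`. -/
theorem rep_boost_eq_log (σ : ℝ) (f : SmoothCircle) (α φ : ℝ) :
    (rep σ (boost α) f : ℝ → ℂ) φ =
      (((Real.cosh α - Real.sinh α * Real.cos φ) ^ σ : ℝ) : ℂ) *
        (f : ℝ → ℂ) ((Complex.log (((-Real.sinh α + Real.cosh α * Real.cos φ : ℝ) +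
          (Real.sin φ : ℝ) * Complex.I) * Complex.exp (-φ * Complex.I))).im + φ) := by
  have hpos := cosh_sub_sinh_mul_cos_pos α φ
  rw [rep_apply, mat_boost_inv, boostMat_neg_mulVec, coneExt]
  congr 1
  apply periodic_congr f.2.2
  rw [angle, Complex.log_im, Real.Angle.coe_add]
  have hz : (⟨-Real.sinh α + Real.cosh α * Real.cos φ, Real.sin φ⟩ : ℂ) =
      ((-Real.sinh α + Real.cosh α * Real.cos φ : ℝ) + (Real.sin φ : ℝ) * Complex.I) := by
    apply Complex.ext <;> simp [-Complex.ofReal_sin, -Complex.ofReal_cos, -Complex.ofReal_sinh,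
      -Complex.ofReal_cosh]
  have hz0 : (⟨-Real.sinh α + Real.cosh α * Real.cos φ, Real.sin φ⟩ : ℂ) ≠ 0 := by
    intro h
    have hre := congrArg Complex.re h
    have him := congrArg Complex.im h
    simp only [Complex.zero_re, Complex.zero_im] at hre him
    have h1 := Real.sin_sq_add_cos_sq φ
    have h2 := Real.cosh_sq α
    have h3 : Real.sinh α = Real.cosh α * Real.cos φ := by linarith
    rw [him] at h1
    rw [h3] at h2
    have : Real.cosh α ^ 2 * (1 - Real.cos φ ^ 2) = 1 := by linarith
    have h4 : 1 - Real.cos φ ^ 2 = 0 := by linarith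
    rw [h4] at this
    linarith
  rw [← hz, Complex.arg_mul_coe_angle hz0 (Complex.exp_ne_zero _)]
  have : (Complex.arg (Complex.exp (-φ * Complex.I)) : Real.Angle) = ((-φ : ℝ) : Real.Angle) := by
    have := Complex.arg_cos_add_sin_mul_I_coe_angle ((-φ : ℝ) : Real.Angle)
    rw [Real.Angle.cos_coe, Real.Angle.sin_coe, Complex.ofReal_cos, Complex.ofReal_sin,
      ← Complex.exp_mul_I, Complex.ofReal_neg] at this
    exact this
  rw [this, Real.Angle.coe_neg, neg_add_cancel_right]
  rfl

theorem hasDerivAt_rep_boost_zero (σ : ℝ) (f : SmoothCircle) (φ : ℝ) :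
    HasDerivAt (fun α => (rep σ (boost α) f : ℝ → ℂ) φ) ((boostGen σ f : ℝ → ℂ) φ) 0 := by
  simp only [rep_boost_eq_log]
  have hw : HasDerivAt (fun α => Real.cosh α - Real.sinh α * Real.cos φ) (-Real.cos φ) 0 := by
    have := (Real.hasDerivAt_cosh 0).fun_sub ((Real.hasDerivAt_sinh 0).mul_const (Real.cos φ))
    simpa using this
  have hwσ : HasDerivAt (fun α => (Real.cosh α - Real.sinh α * Real.cos φ) ^ σ)
      (-Real.cos φ * σ) 0 := by
    have := hw.rpow_const (p := σ) (Or.inl (by simp))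
    simpa using this
  have hz : HasDerivAt (fun α : ℝ => ((-Real.sinh α + Real.cosh α * Real.cos φ : ℝ) +
      (Real.sin φ : ℝ) * Complex.I) * Complex.exp (-φ * Complex.I))
      (-Complex.exp (-φ * Complex.I)) 0 := by
    have h1 : HasDerivAt (fun α => -Real.sinh α + Real.cosh α * Real.cos φ) (-1) 0 := by
      have := (Real.hasDerivAt_sinh 0).fun_neg.fun_add
        ((Real.hasDerivAt_cosh 0).mul_const (Real.cos φ))
      simpa using this
    have := (h1.ofReal_comp.add_const ((Real.sin φ : ℝ) * Complex.I)).mul_const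
      (Complex.exp (-φ * Complex.I))
    simpa using this
  have hz0 : (((-Real.sinh 0 + Real.cosh 0 * Real.cos φ : ℝ) +
      (Real.sin φ : ℝ) * Complex.I) * Complex.exp (-φ * Complex.I)) = 1 := by
    have : ((-Real.sinh 0 + Real.cosh 0 * Real.cos φ : ℝ) + (Real.sin φ : ℝ) * Complex.I : ℂ)
        = Complex.exp (φ * Complex.I) := by
      rw [Complex.exp_mul_I]; simp
    rw [this, ← Complex.exp_add]
    simp
  have hlog : HasDerivAt (fun α : ℝ => (Complex.log (((-Real.sinh α + Real.cosh α * Real.cos φ : ℝ)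
      + (Real.sin φ : ℝ) * Complex.I) * Complex.exp (-φ * Complex.I))).im + φ)
      (Real.sin φ) 0 := by
    have h := hz.clog_real (by rw [hz0]; exact Complex.one_mem_slitPlane)
    rw [hz0, div_one] at h
    have h2 := (Complex.imCLM.hasFDerivAt.comp_hasDerivAt (0 : ℝ) h).add_const φ
    have e : Complex.imCLM (-Complex.exp (-φ * Complex.I)) = Real.sin φ := by
      rw [show (-φ * Complex.I : ℂ) = ((-φ : ℝ) : ℂ) * Complex.I by push_cast; ring]
      rw [Complex.imCLM_apply, Complex.neg_im, Complex.exp_ofReal_mul_I_im, Real.sin_neg, neg_neg]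
    rw [e] at h2
    exact h2
  have hval : (Complex.log (((-Real.sinh 0 + Real.cosh 0 * Real.cos φ : ℝ)
      + (Real.sin φ : ℝ) * Complex.I) * Complex.exp (-φ * Complex.I))).im + φ = φ := by
    rw [hz0]; simp
  have hf : HasDerivAt (f : ℝ → ℂ) ((derivCircle f : ℝ → ℂ) φ)
      ((Complex.log (((-Real.sinh 0 + Real.cosh 0 * Real.cos φ : ℝ)
      + (Real.sin φ : ℝ) * Complex.I) * Complex.exp (-φ * Complex.I))).im + φ) := by
    rw [hval]; exact (differentiable_circle f φ).hasDerivAt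
  have h := hwσ.ofReal_comp.mul (HasDerivAt.scomp (0 : ℝ) hf hlog)
  refine h.congr_deriv ?_
  simp only [Function.comp_apply, hval]
  rw [boostGen_apply]
  simp
  ring

theorem hasDerivAt_rep_boost (σ : ℝ) (f : SmoothCircle) (α φ : ℝ) :
    HasDerivAt (fun α => (rep σ (boost α) f : ℝ → ℂ) φ)
      ((boostGen σ (rep σ (boost α) f) : ℝ → ℂ) φ) α := by
  have h := hasDerivAt_rep_boost_zero σ (rep σ (boost α) f) φ
  rw [← sub_self α] at h
  have h' := h.comp_sub_const (x := α) (a := α)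
  refine h'.congr_of_eventuallyEq (Eventually.of_forall fun β => ?_)
  change _ = (rep σ (boost (β - α)) (rep σ (boost α) f) : ℝ → ℂ) φ
  rw [← Module.End.mul_apply, ← map_mul, ← boost_add, sub_add_cancel]

theorem hasDerivAt_fourierC_rep_boost (σ : ℝ) (f : SmoothCircle) (m : ℤ) (α : ℝ) :
    HasDerivAt (fun α => fourierC (rep σ (boost α) f) m)
      (fourierC (boostGen σ (rep σ (boost α) f)) m) α := by
  have hfam := (isSmoothFamily_boost σ f).boostGen σ
  obtain ⟨C, hC⟩ := hfam.exists_bound (|α| + 1)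
  have hc (g : SmoothCircle) : Continuous fun φ : ℝ =>
      (g : ℝ → ℂ) φ * Complex.exp (-(Complex.I * m * φ)) :=
    (continuous_circle g).mul (by fun_prop)
  refine HasDerivAt.const_mul _ (intervalIntegral.hasDerivAt_integral_of_dominated_loc_of_deriv_le
    (F' := fun α φ => (boostGen σ (rep σ (boost α) f) : ℝ → ℂ) φ *
      Complex.exp (-(Complex.I * m * φ))) (bound := fun _ => C)
    (s := Icc (-(|α| + 1)) (|α| + 1)) (Icc_mem_nhds ?_ ?_)
    (Eventually.of_forall fun β => (hc _).aestronglyMeasurable)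
    ((hc _).intervalIntegrable _ _) (hc _).aestronglyMeasurable
    (Eventually.of_forall fun φ _ β hβ => ?_) intervalIntegrable_const
    (Eventually.of_forall fun φ _ β _ => (hasDerivAt_rep_boost σ f β φ).mul_const _)).2
  · linarith [neg_abs_le α]
  · linarith [le_abs_self α]
  · rw [norm_mul, norm_exp_neg_I_mul_int_mul, mul_one]
    exact hC β hβ φ

/-! ### Invariance of the form -/

theorem fourierC_rep_rot (σ θ : ℝ) (f : SmoothCircle) (m : ℤ) :
    fourierC (rep σ (rot θ) f) m = Complex.exp (-(Complex.I * m * θ)) * fourierC f m := by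
  let h : ℝ → ℂ := fun φ => (f : ℝ → ℂ) φ * Complex.exp (-(Complex.I * m * φ))
  have hper : Function.Periodic h (2 * Real.pi) := fun φ => by
    have := exp_I_mul_int_mul_add_two_pi (-m) φ
    simp only [h, f.2.2 φ]
    congr 1
    push_cast at this ⊢
    simpa using this
  have e (φ : ℝ) : (rep σ (rot θ) f : ℝ → ℂ) φ * Complex.exp (-(Complex.I * m * φ)) =
      Complex.exp (-(Complex.I * m * θ)) * h (φ - θ) := by
    simp only [h]
    rw [rep_rot_apply, mul_left_comm, ← Complex.exp_add]
    congr 2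
    push_cast
    ring
  have hs : ∫ φ in (0 : ℝ)..(2 * Real.pi), h (φ - θ) = ∫ φ in (0 : ℝ)..(2 * Real.pi), h φ := by
    rw [intervalIntegral.integral_comp_sub_right]
    have := hper.intervalIntegral_add_eq (0 - θ) 0
    rw [zero_add] at this
    rw [← this]
    congr 1
    ring
  simp only [fourierC, e]
  rw [intervalIntegral.integral_const_mul, hs]
  ring

theorem weightForm_rot {σ : ℝ} (θ : ℝ) (f₁ f₂ : SmoothCircle) :
    weightForm σ (rep σ (rot θ) f₁) (rep σ (rot θ) f₂) = weightForm σ f₁ f₂ := by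
  refine tsum_congr fun m => ?_
  have h : conj (Complex.exp (-(Complex.I * m * θ))) * Complex.exp (-(Complex.I * m * θ)) = 1 := by
    rw [Complex.conj_mul', norm_exp_neg_I_mul_int_mul]; simp
  rw [fourierC_rep_rot, fourierC_rep_rot, map_mul]
  linear_combination ((weight σ m : ℂ) * conj (fourierC f₁ m) * fourierC f₂ m) * h

/-- The generator of boosts is skew-symmetric for the form: by the recurrence of the weights the
series telescopes. -/
theorem tsum_boostGen_skew {σ : ℝ} (h1 : -1 < σ) (h0 : σ < 0) (f₁ f₂ : SmoothCircle) :
    ∑' m : ℤ, ((weight σ m : ℂ) * conj (fourierC (boostGen σ f₁) m) * fourierC f₂ m +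
      (weight σ m : ℂ) * conj (fourierC f₁ m) * fourierC (boostGen σ f₂) m) = 0 := by
  have hσ := ne_int_of_mem_strip h1 h0
  let t : ℤ → ℂ := fun m => (weight σ m : ℂ) * (m + 1 + σ) / 2 *
    (conj (fourierC f₁ m) * fourierC f₂ (m + 1) + conj (fourierC f₁ (m + 1)) * fourierC f₂ m)
  have hterm (m : ℤ) : (weight σ m : ℂ) * conj (fourierC (boostGen σ f₁) m) * fourierC f₂ m +
      (weight σ m : ℂ) * conj (fourierC f₁ m) * fourierC (boostGen σ f₂) m = t (m - 1) - t m := by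
    have hw : (weight σ m : ℂ) * (m - 1 - σ) = (weight σ (m - 1) : ℂ) * (m + σ) := by
      have := weight_succ hσ (m - 1)
      rw [sub_add_cancel] at this
      push_cast at this
      have h' : weight σ m * (m - 1 - σ) = weight σ (m - 1) * (m + σ) := by rw [this]; ring
      exact_mod_cast h'
    simp only [t, fourierC_boostGen, sub_add_cancel, map_div₀, map_sub, map_mul, map_add,
      Complex.conj_ofReal, map_one, map_intCast, map_ofNat]
    push_cast
    linear_combination (1 / 2 : ℂ) * (conj (fourierC f₁ (m - 1)) * fourierC f₂ m +
      conj (fourierC f₁ m) * fourierC f₂ (m - 1)) * hw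
  -- the telescoped terms are themselves terms of summable form series
  have hsum : Summable t := by
    obtain ⟨C, hC⟩ := exists_weight_mul_norm_fourierC_le h1 h0 f₁
    have hS : Summable fun m : ℤ => C * ((|(m : ℝ)| + 1) * ‖fourierC f₂ m‖) := by
      simpa only [pow_one, add_mul, one_mul] using
        ((summable_pow_mul_norm_fourierC f₂ 1).add (summable_norm_fourierC f₂)).mul_left C
    have hS' := (Equiv.addRight (1 : ℤ)).summable_iff.2 hS
    refine Summable.of_norm_bounded (hS.add hS') fun m => ?_
    have hw := weight_pos h1 h0 m
    have hw' := weight_pos h1 h0 (m + 1)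
    have hrec : (weight σ m : ℂ) * (m + 1 + σ) = (weight σ (m + 1) : ℂ) * (m - σ) := by
      exact_mod_cast (weight_succ hσ m).symm
    have e : t m = 2⁻¹ * (((weight σ m : ℂ) * conj (fourierC f₁ m)) *
        ((m + 1 + σ) * fourierC f₂ (m + 1)) + ((weight σ (m + 1) : ℂ) *
        conj (fourierC f₁ (m + 1))) * ((m - σ) * fourierC f₂ m)) := by
      simp only [t]
      linear_combination (1 / 2 : ℂ) * conj (fourierC f₁ (m + 1)) * fourierC f₂ m * hrec
    have b1 : ‖(m + 1 + σ : ℂ)‖ ≤ |((m + 1 : ℤ) : ℝ)| + 1 := by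
      rw [show (m + 1 + σ : ℂ) = ((((m + 1 : ℤ) : ℝ) + σ : ℝ) : ℂ) by push_cast; rfl,
        Complex.norm_real]
      refine (norm_add_le _ _).trans (add_le_add le_rfl ?_)
      rw [Real.norm_eq_abs, abs_le]
      constructor <;> linarith
    have b2 : ‖(m - σ : ℂ)‖ ≤ |(m : ℝ)| + 1 := by
      rw [show (m - σ : ℂ) = (((m : ℝ) - σ : ℝ) : ℂ) by push_cast; rfl, Complex.norm_real]
      refine (norm_sub_le _ _).trans (add_le_add le_rfl ?_)
      rw [Real.norm_eq_abs, abs_le]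
      constructor <;> linarith
    have a1 : ‖(weight σ m : ℂ) * conj (fourierC f₁ m)‖ ≤ C := by
      rw [norm_mul, Complex.norm_real, Real.norm_of_nonneg hw.le, RCLike.norm_conj]
      exact hC m
    have a2 : ‖(weight σ (m + 1) : ℂ) * conj (fourierC f₁ (m + 1))‖ ≤ C := by
      rw [norm_mul, Complex.norm_real, Real.norm_of_nonneg hw'.le, RCLike.norm_conj]
      exact hC (m + 1)
    have hC0 := (norm_nonneg _).trans a1
    have c1 := mul_le_mul a1 (mul_le_mul_of_nonneg_right b1 (norm_nonneg (fourierC f₂ (m + 1))))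
      (by positivity) hC0
    have c2 := mul_le_mul a2 (mul_le_mul_of_nonneg_right b2 (norm_nonneg (fourierC f₂ m)))
      (by positivity) hC0
    rw [← norm_mul, ← norm_mul] at c1 c2
    rw [e, norm_mul, norm_inv, Complex.norm_ofNat]
    have hadd := (norm_add_le _ _).trans (add_le_add c1 c2)
    have h' := norm_nonneg (((weight σ m : ℂ) * conj (fourierC f₁ m)) *
        ((m + 1 + σ) * fourierC f₂ (m + 1)) + ((weight σ (m + 1) : ℂ) *
        conj (fourierC f₁ (m + 1))) * ((m - σ) * fourierC f₂ m))
    simp only [Function.comp_apply, Equiv.coe_addRight]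
    linarith
  simp only [hterm]
  have hsum' : Summable fun m => t (m - 1) := (Equiv.subRight (1 : ℤ)).summable_iff.2 hsum
  rw [hsum'.tsum_sub hsum, sub_eq_zero]
  exact (Equiv.subRight (1 : ℤ)).tsum_eq t

theorem hasDerivAt_weightForm_boost {σ : ℝ} (h1 : -1 < σ) (h0 : σ < 0) (f₁ f₂ : SmoothCircle)
    (α : ℝ) : HasDerivAt
      (fun α => weightForm σ (rep σ (boost α) f₁) (rep σ (boost α) f₂)) 0 α := by
  obtain ⟨K, hK⟩ := weight_le h1 h0
  set R := |α| + 1 with hR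
  obtain ⟨C₁, hC₁⟩ := (isSmoothFamily_boost σ f₁).exists_norm_fourierC_le R
  obtain ⟨C₂, hC₂⟩ := (isSmoothFamily_boost σ f₂).exists_norm_fourierC_le R
  obtain ⟨D₁, hD₁⟩ := ((isSmoothFamily_boost σ f₁).boostGen σ).exists_norm_fourierC_le R
  obtain ⟨D₂, hD₂⟩ := ((isSmoothFamily_boost σ f₂).boostGen σ).exists_norm_fourierC_le R
  have hα : α ∈ Ioo (-R) R := ⟨by linarith [neg_abs_le α], by linarith [le_abs_self α]⟩
  have hbound (m : ℤ) {x y : ℂ} {C D : ℝ} (hx : ‖x‖ ≤ C * (1 + (m : ℝ) ^ 2)⁻¹)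
      (hy : ‖y‖ ≤ D * (1 + (m : ℝ) ^ 2)⁻¹) :
      ‖(weight σ m : ℂ) * conj x * y‖ ≤ K * C * D * (1 + (m : ℝ) ^ 2)⁻¹ := by
    have hp : 0 < 1 + (m : ℝ) ^ 2 := by positivity
    have hw := weight_pos h1 h0 m
    have hC := (norm_nonneg x).trans hx
    rw [norm_mul, norm_mul, Complex.norm_real, Real.norm_of_nonneg hw.le, RCLike.norm_conj]
    calc _ ≤ (K * (1 + (m : ℝ) ^ 2)) * (C * (1 + (m : ℝ) ^ 2)⁻¹) * (D * (1 + (m : ℝ) ^ 2)⁻¹) :=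
          mul_le_mul (mul_le_mul (hK m) hx (norm_nonneg _) (hw.le.trans (hK m))) hy
            (norm_nonneg _) (mul_nonneg (hw.le.trans (hK m)) hC)
      _ = _ := by field_simp
  rw [← tsum_boostGen_skew h1 h0 (rep σ (boost α) f₁) (rep σ (boost α) f₂)]
  refine hasDerivAt_tsum_of_isPreconnected (t := Ioo (-R) R)
    (u := fun m : ℤ => (K * D₁ * C₂ + K * C₁ * D₂) * (1 + (m : ℝ) ^ 2)⁻¹)
    (g' := fun (m : ℤ) α => (weight σ m : ℂ) * conj (fourierC (boostGen σ (rep σ (boost α) f₁)) m) *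
        fourierC (rep σ (boost α) f₂) m +
      (weight σ m : ℂ) * conj (fourierC (rep σ (boost α) f₁) m) *
        fourierC (boostGen σ (rep σ (boost α) f₂)) m)
    (summable_inv_one_add_sq.mul_left _) isOpen_Ioo isPreconnected_Ioo (fun m β _ => ?_)
    (fun m β hβ => ?_) hα (summable_weight_mul h1 h0 _ _) hα
  · exact ((hasDerivAt_fourierC_rep_boost σ f₁ m β).star.const_mul _).mul
      (hasDerivAt_fourierC_rep_boost σ f₂ m β)
  · have hβ' : β ∈ Icc (-R) R := ⟨hβ.1.le, hβ.2.le⟩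
    refine (norm_add_le _ _).trans ?_
    rw [add_mul]
    exact add_le_add (hbound m (hD₁ β hβ' m) (hC₂ β hβ' m)) (hbound m (hC₁ β hβ' m) (hD₂ β hβ' m))

theorem weightForm_boost {σ : ℝ} (h1 : -1 < σ) (h0 : σ < 0) (α : ℝ) (f₁ f₂ : SmoothCircle) :
    weightForm σ (rep σ (boost α) f₁) (rep σ (boost α) f₂) = weightForm σ f₁ f₂ := by
  have h := is_const_of_deriv_eq_zero
    (fun α => (hasDerivAt_weightForm_boost h1 h0 f₁ f₂ α).differentiableAt)
    (fun α => (hasDerivAt_weightForm_boost h1 h0 f₁ f₂ α).deriv) α 0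
  simpa only [boost_zero, map_one, Module.End.one_apply] using h

theorem weightForm_rep {σ : ℝ} (h1 : -1 < σ) (h0 : σ < 0) (g : G) (f₁ f₂ : SmoothCircle) :
    weightForm σ (rep σ g f₁) (rep σ g f₂) = weightForm σ f₁ f₂ := by
  obtain ⟨φ₁, α, φ₂, rfl⟩ := cartan_decomposition g
  simp only [map_mul, Module.End.mul_apply]
  rw [weightForm_rot, weightForm_boost h1 h0, weightForm_rot]

/-! ### Irreducibility in the space of smooth functions -/

/-- The mean value of `e^{ikθ}` over the `N`-th roots of unity. -/
noncomputable def rootMean (N : ℕ) (k : ℤ) : ℂ :=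
  (N : ℂ)⁻¹ * ∑ j ∈ Finset.range N, Complex.exp (Complex.I * k * ((2 * Real.pi * j / N : ℝ) : ℂ))

theorem norm_rootMean_le (N : ℕ) (k : ℤ) : ‖rootMean N k‖ ≤ 1 := by
  have h : ‖∑ j ∈ Finset.range N, Complex.exp (Complex.I * k * ((2 * Real.pi * j / N : ℝ) : ℂ))‖
      ≤ N := by
    refine (norm_sum_le _ _).trans ?_
    simp only [norm_exp_I_mul_int_mul]
    simp
  rw [rootMean, norm_mul, norm_inv, Complex.norm_natCast]
  exact inv_mul_le_one_of_le₀ h (Nat.cast_nonneg _)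

theorem rootMean_zero {N : ℕ} (hN : N ≠ 0) : rootMean N 0 = 1 := by
  have : (N : ℂ) ≠ 0 := by exact_mod_cast hN
  simp [rootMean, this]

theorem rootMean_eq_zero {N : ℕ} {k : ℤ} (hk : k ≠ 0) (hN : k.natAbs < N) : rootMean N k = 0 := by
  have hN0 : (N : ℂ) ≠ 0 := by exact_mod_cast (by omega : N ≠ 0)
  have hpi : (Real.pi : ℂ) ≠ 0 := by exact_mod_cast Real.pi_ne_zero
  set ζ : ℂ := Complex.exp (Complex.I * k * (2 * Real.pi / N)) with hζ
  have hpow (j : ℕ) : Complex.exp (Complex.I * k * ((2 * Real.pi * j / N : ℝ) : ℂ)) = ζ ^ j := by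
    rw [hζ, ← Complex.exp_nat_mul]; congr 1; push_cast; ring
  have hζN : ζ ^ N = 1 := by
    rw [hζ, ← Complex.exp_nat_mul, Complex.exp_eq_one_iff]
    exact ⟨k, by field_simp⟩
  have hζ1 : ζ ≠ 1 := by
    rw [hζ, Ne, Complex.exp_eq_one_iff]
    rintro ⟨n, hn⟩
    have h1 : (k : ℂ) = n * N := by
      field_simp at hn
      rw [hn, mul_comm]
    have h2 : k = n * N := by exact_mod_cast h1
    rw [h2, Int.natAbs_mul, Int.natAbs_natCast] at hN
    rcases Nat.eq_zero_or_pos n.natAbs with h0 | h0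
    · exact hk (by rw [h2, Int.natAbs_eq_zero.1 h0, zero_mul])
    · nlinarith
  simp only [rootMean, hpow]
  rw [geom_sum_eq hζ1, hζN, sub_self, zero_div, mul_zero]

theorem tendsto_rootMean (k : ℤ) :
    Tendsto (fun N : ℕ => rootMean (N + 1) k) atTop (𝓝 (if k = 0 then 1 else 0)) := by
  refine tendsto_const_nhds.congr' ?_
  filter_upwards [eventually_ge_atTop k.natAbs] with N hN
  split_ifs with hk
  · rw [hk, rootMean_zero (Nat.succ_ne_zero N)]
  · rw [rootMean_eq_zero hk (by omega)]

/-- A closed subspace invariant under rotations contains the Fourier components of its elements: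
they are limits of means over finite groups of rotations. -/
theorem fourierC_smul_expCircle_mem {W : Submodule ℂ SmoothCircle} (hW : IsSmoothClosed W) {σ : ℝ}
    (hinv : ∀ g, ∀ f ∈ W, rep σ g f ∈ W) {f : SmoothCircle} (hf : f ∈ W) (m : ℤ) :
    fourierC f m • expCircle m ∈ W := by
  let u : ℕ → SmoothCircle := fun N => ((N + 1 : ℕ) : ℂ)⁻¹ • ∑ j ∈ Finset.range (N + 1),
    Complex.exp (Complex.I * m * ((2 * Real.pi * j / (N + 1 : ℕ) : ℝ) : ℂ)) •
      rep σ (rot (2 * Real.pi * j / (N + 1 : ℕ))) f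
  have hu (N : ℕ) (n : ℤ) : fourierC (u N) n = rootMean (N + 1) (m - n) * fourierC f n := by
    simp only [u, fourierC_smul, fourierC_sum, fourierC_rep_rot, rootMean]
    rw [mul_assoc, Finset.sum_mul]
    congr 1
    refine Finset.sum_congr rfl fun j _ => ?_
    rw [← mul_assoc, ← Complex.exp_add]
    congr 2
    push_cast
    ring
  refine mem_of_dominated hW (u := u) (g := f) (fun N => ?_) (fun n => ?_) (fun N n => ?_)
  · exact W.smul_mem _ (W.sum_mem fun j _ => W.smul_mem _ (hinv _ f hf))
  · simp only [hu, fourierC_smul, fourierC_expCircle]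
    have := (tendsto_rootMean (m - n)).mul_const (fourierC f n)
    convert this using 2
    by_cases h : n = m
    · simp [h]
    · simp [h, sub_ne_zero.2 (Ne.symm h)]
  · rw [hu, norm_mul]
    exact mul_le_of_le_one_left (norm_nonneg _) (norm_rootMean_le _ _)

/-- Boosts connect neighbouring exponentials. -/
theorem exists_fourierC_boost_ne_zero {σ : ℝ} (hσ : ∀ n : ℤ, σ ≠ n) {m n : ℤ}
    (hn : n = m + 1 ∨ n = m - 1) : ∃ α, fourierC (rep σ (boost α) (expCircle m)) n ≠ 0 := by
  by_contra! h
  have hd := hasDerivAt_fourierC_rep_boost σ (expCircle m) n 0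
  simp only [h, boost_zero, map_one, Module.End.one_apply] at hd
  have h0 := hd.unique (hasDerivAt_const 0 0)
  rw [fourierC_boostGen, fourierC_expCircle, fourierC_expCircle] at h0
  rcases hn with rfl | rfl
  · rw [add_sub_cancel_right, if_pos rfl, if_neg (by omega)] at h0
    push_cast at h0
    have h' : ((m : ℝ) : ℂ) - σ = 0 := by push_cast; linear_combination 2 * h0
    exact hσ m (by exact_mod_cast (sub_eq_zero.1 h').symm)
  · rw [sub_add_cancel, if_pos rfl, if_neg (by omega)] at h0
    push_cast at h0
    have h' : (σ : ℂ) = ((-m : ℤ) : ℝ) := by push_cast; linear_combination -2 * h0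
    exact hσ (-m) (by exact_mod_cast h')

theorem forall_int_of_neighbours {P : ℤ → Prop} {m : ℤ} (hm : P m)
    (h : ∀ m n, P m → (n = m + 1 ∨ n = m - 1) → P n) (n : ℤ) : P n := by
  induction n using Int.inductionOn' (b := m) with
  | zero => exact hm
  | succ k _ hk => exact h k _ hk (Or.inl rfl)
  | pred k _ hk => exact h k _ hk (Or.inr rfl)

theorem isSmoothIrreducible_rep {σ : ℝ} (hσ : ∀ n : ℤ, σ ≠ n) : IsSmoothIrreducible (rep σ) := by
  intro W hW hinv
  rw [or_iff_not_imp_left]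
  intro hne
  obtain ⟨f, hf, hf0⟩ := (Submodule.ne_bot_iff W).1 hne
  obtain ⟨m, hm⟩ := exists_fourierC_ne_zero hf0
  have hmem {f : SmoothCircle} {m : ℤ} (hf : f ∈ W) (hm : fourierC f m ≠ 0) : expCircle m ∈ W :=
    (W.smul_mem_iff hm).1 (fourierC_smul_expCircle_mem hW hinv hf m)
  refine eq_top_of_expCircle_mem hW (forall_int_of_neighbours (hmem hf hm) fun m n h hn => ?_)
  obtain ⟨α, hα⟩ := exists_fourierC_boost_ne_zero hσ hn
  exact hmem (hinv (boost α) _ h) hα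

/-! ### The unitary representation in the Hilbert space completion -/

/-- An isometric representation on a dense subspace extends to a unitary representation. -/
theorem exists_unitary_extension {V H : Type*} [AddCommGroup V] [Module ℂ V]
    [NormedAddCommGroup H] [InnerProductSpace ℂ H] [CompleteSpace H] (ρ : Representation ℂ G V)
    (ι : V →ₗ[ℂ] H) (hι : DenseRange ι) (hiso : ∀ g v, ‖ι (ρ g v)‖ = ‖ι v‖) :
    ∃ U : G →* (H ≃ₗᵢ[ℂ] H), ∀ g v, U g (ι v) = ι (ρ g v) := by
  have hinv (g : G) (v : V) : ρ g (ρ g⁻¹ v) = v := by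
    rw [← Module.End.mul_apply, ← map_mul, mul_inv_cancel, map_one, Module.End.one_apply]
  let e : G → (V ≃ₗ[ℂ] V) := fun g => LinearEquiv.ofLinearMap (ρ g) (ρ g⁻¹)
    (LinearMap.ext fun v => hinv g v)
    (LinearMap.ext fun v => by simp)
  let E : G → (H ≃ₗᵢ[ℂ] H) := fun g => (e g).extendOfIsometry ι ι hι hι (hiso g)
  have hE (g : G) (v : V) : E g (ι v) = ι (ρ g v) :=
    LinearEquiv.extendOfIsometry_eq (e g) ι ι hι hι (hiso g) v
  refine ⟨MonoidHom.mk' E fun g h => ?_, hE⟩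
  ext x
  refine hι.induction_on (p := fun x => E (g * h) x = (E g * E h) x) x
    (isClosed_eq (E (g * h)).continuous ((E g).continuous.comp (E h).continuous)) fun v => ?_
  change E (g * h) (ι v) = E g (E h (ι v))
  rw [hE, hE, hE, map_mul, Module.End.mul_apply]

/-- The Hilbert space of square-summable sequences over `ℤ`. -/
abbrev EllTwo : Type := lp (fun _ : ℤ => ℂ) 2

theorem memℓp_sqrt_weight {c₀ σ : ℝ} (h1 : -1 < σ) (h0 : σ < 0) (hc : 0 < c₀) (f : SmoothCircle) :
    Memℓp (fun m : ℤ => ((Real.sqrt (formConst c₀ σ * weight σ m) : ℝ) : ℂ) * fourierC f m) 2 := by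
  apply memℓp_gen
  have hs := (summable_weight_mul h1 h0 f f).norm.mul_left (formConst c₀ σ)
  refine hs.congr fun m => ?_
  have hA := formConst_pos hc h0
  have hw := weight_pos h1 h0 m
  have hs : ‖((Real.sqrt (formConst c₀ σ * weight σ m) : ℝ) : ℂ)‖ ^ 2 =
      formConst c₀ σ * weight σ m := by
    rw [Complex.norm_real, Real.norm_of_nonneg (Real.sqrt_nonneg _),
      Real.sq_sqrt (by positivity)]
  have hs' : ‖(weight σ m : ℂ)‖ = weight σ m := by
    rw [Complex.norm_real, Real.norm_of_nonneg hw.le]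
  simp only [ENNReal.toReal_ofNat, Real.rpow_ofNat, norm_mul, mul_pow, hs, hs', RCLike.norm_conj]
  ring

/-- The isometric embedding of the smooth functions into `ℓ²(ℤ)` by weighted Fourier
coefficients. -/
noncomputable def toEllTwo {c₀ σ : ℝ} (h1 : -1 < σ) (h0 : σ < 0) (hc : 0 < c₀) :
    SmoothCircle →ₗ[ℂ] EllTwo where
  toFun f := ⟨_, memℓp_sqrt_weight h1 h0 hc f⟩
  map_add' f g := by
    ext m
    simp only [fourierC_add, mul_add]
    rfl
  map_smul' c f := by
    ext m
    simp only [fourierC_smul, mul_left_comm _ c]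
    rfl

section

variable {c₀ σ : ℝ} (h1 : -1 < σ) (h0 : σ < 0) (hc : 0 < c₀)

theorem toEllTwo_apply (f : SmoothCircle) (m : ℤ) : toEllTwo h1 h0 hc f m =
    ((Real.sqrt (formConst c₀ σ * weight σ m) : ℝ) : ℂ) * fourierC f m := rfl

theorem sqrt_weight_ne_zero (h1 : -1 < σ) (h0 : σ < 0) (hc : 0 < c₀) (m : ℤ) :
    ((Real.sqrt (formConst c₀ σ * weight σ m) : ℝ) : ℂ) ≠ 0 := by
  have hA := formConst_pos hc h0
  have hw := weight_pos h1 h0 m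
  exact_mod_cast (Real.sqrt_pos.2 (mul_pos hA hw)).ne'

theorem inner_toEllTwo (f₁ f₂ : SmoothCircle) :
    inner ℂ (toEllTwo h1 h0 hc f₁) (toEllTwo h1 h0 hc f₂) = diagForm c₀ σ f₁ f₂ := by
  rw [lp.inner_eq_tsum, diagForm_eq (ne_int_of_mem_strip h1 h0), weightForm, ← tsum_mul_left]
  refine tsum_congr fun m => ?_
  have hA := formConst_pos hc h0
  have hw := weight_pos h1 h0 m
  have hs : ((Real.sqrt (formConst c₀ σ * weight σ m) : ℝ) : ℂ) *
      ((Real.sqrt (formConst c₀ σ * weight σ m) : ℝ) : ℂ) =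
      (formConst c₀ σ : ℂ) * (weight σ m : ℂ) := by
    rw [← Complex.ofReal_mul, Real.mul_self_sqrt (by positivity), Complex.ofReal_mul]
  rw [toEllTwo_apply, toEllTwo_apply, RCLike.inner_apply, map_mul, Complex.conj_ofReal]
  linear_combination (conj (fourierC f₁ m) * fourierC f₂ m) * hs

theorem toEllTwo_expCircle (m : ℤ) : toEllTwo h1 h0 hc (expCircle m) =
    ((Real.sqrt (formConst c₀ σ * weight σ m) : ℝ) : ℂ) • lp.single 2 m (1 : ℂ) := by
  ext n
  rw [toEllTwo_apply, fourierC_expCircle, lp.coeFn_smul, Pi.smul_apply, lp.single_apply]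
  by_cases h : n = m
  · subst h; simp
  · simp [h]

theorem eq_top_of_single_mem {W : Submodule ℂ EllTwo} (hW : IsClosed (W : Set EllTwo))
    (h : ∀ m, lp.single 2 m (1 : ℂ) ∈ W) : W = ⊤ := by
  rw [eq_top_iff]
  intro x _
  have hs := lp.hasSum_single (E := fun _ : ℤ => ℂ) (p := 2) (by norm_num) x
  refine hW.mem_of_tendsto hs (Eventually.of_forall fun s => W.sum_mem fun m _ => ?_)
  have : lp.single 2 m (x m) = x m • lp.single (E := fun _ : ℤ => ℂ) 2 m (1 : ℂ) := by
    rw [← lp.single_smul]; simp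
  rw [this]
  exact W.smul_mem _ (h m)

theorem denseRange_toEllTwo : DenseRange (toEllTwo h1 h0 hc) := by
  have h := eq_top_of_single_mem
    (W := (LinearMap.range (toEllTwo h1 h0 hc)).topologicalClosure)
    (Submodule.isClosed_topologicalClosure _) fun m => by
      apply Submodule.le_topologicalClosure
      have : toEllTwo h1 h0 hc (expCircle m) ∈ LinearMap.range (toEllTwo h1 h0 hc) := ⟨_, rfl⟩
      rw [toEllTwo_expCircle] at this
      exact (Submodule.smul_mem_iff _ (sqrt_weight_ne_zero h1 h0 hc m)).1 this
  have h' := Submodule.dense_iff_topologicalClosure_eq_top.2 h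
  rwa [LinearMap.coe_range] at h'

theorem diagForm_rep (h1 : -1 < σ) (h0 : σ < 0) (g : G) (f₁ f₂ : SmoothCircle) :
    diagForm c₀ σ (rep σ g f₁) (rep σ g f₂) = diagForm c₀ σ f₁ f₂ := by
  rw [diagForm_eq (ne_int_of_mem_strip h1 h0), diagForm_eq (ne_int_of_mem_strip h1 h0),
    weightForm_rep h1 h0]

theorem norm_toEllTwo_rep (g : G) (f : SmoothCircle) :
    ‖toEllTwo h1 h0 hc (rep σ g f)‖ = ‖toEllTwo h1 h0 hc f‖ := by
  rw [← sq_eq_sq₀ (norm_nonneg _) (norm_nonneg _), ← inner_self_eq_norm_sq (𝕜 := ℂ),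
    ← inner_self_eq_norm_sq (𝕜 := ℂ), inner_toEllTwo, inner_toEllTwo, diagForm_rep h1 h0]

theorem eventually_rep_sub_le (σ : ℝ) (f : SmoothCircle) (g₀ : G) {ε : ℝ} (hε : 0 < ε) :
    ∀ᶠ g in 𝓝 g₀, ∀ φ, ‖((rep σ g f - rep σ g₀ f : SmoothCircle) : ℝ → ℂ) φ‖ ≤ ε := by
  have hcont : Continuous fun p : G × ℝ => (rep σ p.1 f : ℝ → ℂ) p.2 := by
    simp only [rep_apply]
    rw [continuous_iff_continuousAt]
    intro p
    refine ContinuousAt.comp (f := fun p : G × ℝ => mat p.1⁻¹ *ᵥ conePoint p.2)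
      (contDiffAt_coneExt σ f (by rw [quad_mat, quad_conePoint])
        (mat_conePoint_pos _ _)).continuousAt (Continuous.continuousAt ?_)
    refine Continuous.matrix_mulVec (continuous_mat.comp continuous_fst.inv) ?_
    refine continuous_pi fun i => ?_
    fin_cases i
    · exact continuous_const
    · exact Real.continuous_sin.comp continuous_snd
    · exact Real.continuous_cos.comp continuous_snd
  have h := (isCompact_Icc (a := (0 : ℝ)) (b := 2 * Real.pi)).eventually_forall_of_forall_eventually
    (x₀ := g₀) (P := fun g φ => ‖(rep σ g f : ℝ → ℂ) φ - (rep σ g₀ f : ℝ → ℂ) φ‖ < ε) (by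
      intro φ _
      have hc : Continuous fun p : G × ℝ =>
          ‖(rep σ p.1 f : ℝ → ℂ) p.2 - (rep σ g₀ f : ℝ → ℂ) p.2‖ :=
        (hcont.sub ((continuous_circle (rep σ g₀ f)).comp continuous_snd)).norm
      exact hc.continuousAt.eventually_lt continuousAt_const (by simpa using hε))
  filter_upwards [h] with g hg φ
  obtain ⟨y, hy, hxy⟩ := (rep σ g f - rep σ g₀ f).2.2.exists_mem_Ico₀ Real.two_pi_pos φ
  rw [hxy]
  exact (hg y ⟨hy.1, hy.2.le⟩).le

theorem summable_weight_mul_norm (h1 : -1 < σ) (h0 : σ < 0) (f : SmoothCircle) :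
    Summable fun m => weight σ m * ‖fourierC f m‖ := by
  obtain ⟨K, hK⟩ := weight_le h1 h0
  have hs := ((summable_norm_fourierC f).add (summable_pow_mul_norm_fourierC f 2)).mul_left K
  refine Summable.of_nonneg_of_le (fun m => mul_nonneg (weight_pos h1 h0 m).le (norm_nonneg _))
    (fun m => ?_) hs
  rw [sq_abs]
  calc _ ≤ (K * (1 + (m : ℝ) ^ 2)) * ‖fourierC f m‖ :=
        mul_le_mul_of_nonneg_right (hK m) (norm_nonneg _)
    _ = _ := by ring

/-- With one argument fixed, the form is continuous for uniform convergence of the other one. -/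
theorem norm_weightForm_le (h1 : -1 < σ) (h0 : σ < 0) (f h : SmoothCircle) {ε : ℝ}
    (hε : ∀ φ, ‖(h : ℝ → ℂ) φ‖ ≤ ε) :
    ‖weightForm σ f h‖ ≤ (∑' m, weight σ m * ‖fourierC f m‖) * ε := by
  refine tsum_of_norm_bounded ((summable_weight_mul_norm h1 h0 f).hasSum.mul_right ε) fun m => ?_
  rw [norm_mul, norm_mul, Complex.norm_real, Real.norm_of_nonneg (weight_pos h1 h0 m).le,
    RCLike.norm_conj]
  exact mul_le_mul_of_nonneg_left (norm_fourierC_le h hε m)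
    (mul_nonneg (weight_pos h1 h0 m).le (norm_nonneg _))

theorem continuous_toEllTwo_rep (f : SmoothCircle) :
    Continuous fun g => toEllTwo h1 h0 hc (rep σ g f) := by
  rw [continuous_iff_continuousAt]
  intro g₀
  have hσ := ne_int_of_mem_strip h1 h0
  have hA := formConst_pos hc h0
  set A := formConst c₀ σ
  set S := ∑' m, weight σ m * ‖fourierC (rep σ g₀ f) m‖ with hS
  have hS0 : 0 ≤ S := tsum_nonneg fun m => mul_nonneg (weight_pos h1 h0 m).le (norm_nonneg _)
  -- by invariance, `‖T(g)f - T(g₀)f‖² = -2 re (T(g₀)f, T(g)f - T(g₀)f)`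
  have key (g : G) : ‖toEllTwo h1 h0 hc (rep σ g f) - toEllTwo h1 h0 hc (rep σ g₀ f)‖ ^ 2 =
      -2 * (inner ℂ (toEllTwo h1 h0 hc (rep σ g₀ f))
        (toEllTwo h1 h0 hc (rep σ g f - rep σ g₀ f))).re := by
    rw [map_sub, inner_sub_right, Complex.sub_re, norm_sub_sq (𝕜 := ℂ), norm_toEllTwo_rep,
      norm_toEllTwo_rep, ← inner_re_symm]
    have := inner_self_eq_norm_sq (𝕜 := ℂ) (toEllTwo h1 h0 hc (rep σ g₀ f))
    rw [norm_toEllTwo_rep] at this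
    simp only [RCLike.re_to_complex] at this ⊢
    linarith
  rw [ContinuousAt, Metric.tendsto_nhds]
  intro ε hε
  have hδ : 0 < ε ^ 2 / (4 * A * (S + 1)) := by positivity
  filter_upwards [eventually_rep_sub_le σ f g₀ hδ] with g hg
  rw [dist_eq_norm, ← sq_lt_sq₀ (norm_nonneg _) hε.le, key, inner_toEllTwo, diagForm_eq hσ]
  have hb := norm_weightForm_le h1 h0 (rep σ g₀ f) _ hg
  rw [← hS] at hb
  have hre := Complex.abs_re_le_norm ((A : ℂ) * weightForm σ (rep σ g₀ f) (rep σ g f - rep σ g₀ f))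
  rw [norm_mul, Complex.norm_real, Real.norm_of_nonneg hA.le] at hre
  have hlow := (abs_le.1 (hre.trans (mul_le_mul_of_nonneg_left hb hA.le))).1
  have : A * (S * (ε ^ 2 / (4 * A * (S + 1)))) ≤ ε ^ 2 / 4 := by
    rw [show A * (S * (ε ^ 2 / (4 * A * (S + 1)))) = ε ^ 2 / 4 * (S / (S + 1)) by field_simp]
    exact mul_le_of_le_one_right (by positivity) ((div_le_one (by positivity)).2 (by linarith))
  have : 0 < ε ^ 2 := by positivity
  linarith

theorem continuous_coord (m : ℤ) : Continuous fun x : EllTwo => x m := by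
  have h : (fun x : EllTwo => x m) = fun x => inner ℂ (lp.single 2 m (1 : ℂ)) x := by
    funext x
    rw [lp.inner_single_left]
    simp
  rw [h]
  exact continuous_const.inner continuous_id

/-- A closed subspace of `ℓ²(ℤ)` invariant under rotations, acting by phases on the coordinates,
contains every basis vector that occurs in one of its elements: a vector `y` orthogonal to the
subspace is orthogonal to the means of `x` over finite groups of rotations, hence to their limit
`x m` times the basis vector. -/
theorem single_mem_of_coord_ne_zero {W : Submodule ℂ EllTwo} (hW : IsClosed (W : Set EllTwo))
    (R : ℝ → EllTwo → EllTwo)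
    (hR : ∀ θ x (n : ℤ), R θ x n = Complex.exp (-(Complex.I * n * θ)) * x n)
    (hinv : ∀ θ, ∀ x ∈ W, R θ x ∈ W) {x : EllTwo} (hx : x ∈ W) {m : ℤ} (hm : x m ≠ 0) :
    lp.single 2 m (1 : ℂ) ∈ W := by
  rw [← hW.submodule_topologicalClosure_eq, ← Submodule.orthogonal_orthogonal_eq_closure,
    Submodule.mem_orthogonal]
  intro y hy
  rw [lp.inner_single_right]
  let u : ℕ → EllTwo := fun N => ((N + 1 : ℕ) : ℂ)⁻¹ • ∑ j ∈ Finset.range (N + 1),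
    Complex.exp (Complex.I * m * ((2 * Real.pi * j / (N + 1 : ℕ) : ℝ) : ℂ)) •
      R (2 * Real.pi * j / (N + 1 : ℕ)) x
  have hu (N : ℕ) (n : ℤ) : u N n = rootMean (N + 1) (m - n) * x n := by
    simp only [u, lp.coeFn_smul, lp.coeFn_sum, Pi.smul_apply, Finset.sum_apply, smul_eq_mul, hR,
      rootMean]
    rw [mul_assoc, Finset.sum_mul]
    congr 1
    refine Finset.sum_congr rfl fun j _ => ?_
    rw [← mul_assoc, ← Complex.exp_add]
    congr 2
    push_cast
    ring
  have huW (N : ℕ) : inner ℂ (u N) y = 0 :=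
    hy _ (W.smul_mem _ (W.sum_mem fun j _ => W.smul_mem _ (hinv _ x hx)))
  have hterm (N : ℕ) : inner ℂ y (u N) = ∑' n, rootMean (N + 1) (m - n) * inner ℂ (y n) (x n) := by
    rw [lp.inner_eq_tsum]
    refine tsum_congr fun n => ?_
    rw [hu, RCLike.inner_apply, RCLike.inner_apply]
    ring
  have hlim := tendsto_tsum_of_dominated_convergence (𝓕 := atTop)
    (f := fun N n => rootMean (N + 1) (m - n) * inner ℂ (y n) (x n))
    (g := fun n => (if m - n = 0 then 1 else 0) * inner ℂ (y n) (x n))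
    (lp.summable_inner (𝕜 := ℂ) y x).norm
    (fun n => (tendsto_rootMean (m - n)).mul_const _)
    (Eventually.of_forall fun N n => by
      rw [norm_mul]
      exact mul_le_of_le_one_left (norm_nonneg _) (norm_rootMean_le _ _))
  simp only [← hterm, fun N => inner_eq_zero_symm.1 (huW N)] at hlim
  have h0 := tendsto_nhds_unique tendsto_const_nhds hlim
  rw [tsum_eq_single m (fun n hn => by
    rw [if_neg (sub_ne_zero.2 hn.symm), zero_mul]), sub_self, if_pos rfl, one_mul,
    RCLike.inner_apply] at h0
  have hy0 : y m = 0 := by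
    rcases mul_eq_zero.1 h0.symm with h | h
    · exact absurd h hm
    · simpa using h
  rw [hy0, inner_zero_left]

theorem isIrreducibleUnitary_rep (h1 : -1 < σ) (h0 : σ < 0) (hc : 0 < c₀) :
    IsIrreducibleUnitary (rep σ) (diagForm c₀ σ) := by
  have hσ := ne_int_of_mem_strip h1 h0
  have hdense := denseRange_toEllTwo h1 h0 hc
  obtain ⟨U, hU⟩ := exists_unitary_extension (rep σ) (toEllTwo h1 h0 hc) hdense
    (norm_toEllTwo_rep h1 h0 hc)
  have hnt : Nontrivial EllTwo := by
    refine ⟨⟨lp.single 2 0 (1 : ℂ), 0, fun h => ?_⟩⟩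
    have := congrArg (fun x : EllTwo => x 0) h
    simp at this
  refine ⟨EllTwo, inferInstance, inferInstance, inferInstance, toEllTwo h1 h0 hc, U,
    inner_toEllTwo h1 h0 hc, hdense, hU, fun x => ?_, hnt, fun W hW hinv => ?_⟩
  · refine continuous_of_uniform_approx_of_continuous fun s hs => ?_
    obtain ⟨ε, hε, hεs⟩ := Metric.mem_uniformity_dist.1 hs
    obtain ⟨f, hf⟩ := hdense.exists_dist_lt x hε
    refine ⟨fun g => U g (toEllTwo h1 h0 hc f), ?_, fun g => hεs ?_⟩
    · simp only [hU]
      exact continuous_toEllTwo_rep h1 h0 hc f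
    · rwa [LinearIsometryEquiv.dist_map]
  · rw [or_iff_not_imp_left]
    intro hne
    have hR (θ : ℝ) (x : EllTwo) (n : ℤ) :
        U (rot θ) x n = Complex.exp (-(Complex.I * n * θ)) * x n := by
      refine hdense.induction_on (p := fun x : EllTwo =>
        U (rot θ) x n = Complex.exp (-(Complex.I * n * θ)) * x n) x (isClosed_eq
        ((continuous_coord n).comp (U (rot θ)).continuous)
        (continuous_const.mul (continuous_coord n))) fun f => ?_
      rw [hU, toEllTwo_apply, toEllTwo_apply, fourierC_rep_rot]
      ring
    have hmem {x : EllTwo} (hx : x ∈ W) {m : ℤ} (hm : x m ≠ 0) : lp.single 2 m (1 : ℂ) ∈ W :=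
      single_mem_of_coord_ne_zero hW (fun θ => U (rot θ)) hR (fun θ => hinv _) hx hm
    obtain ⟨x, hx, hx0⟩ := (Submodule.ne_bot_iff W).1 hne
    obtain ⟨m, hm⟩ : ∃ m, x m ≠ 0 := by
      by_contra! h
      exact hx0 (by ext m; exact h m)
    refine eq_top_of_single_mem hW (forall_int_of_neighbours (hmem hx hm) fun m n h hn => ?_)
    obtain ⟨α, hα⟩ := exists_fourierC_boost_ne_zero hσ hn
    have he : toEllTwo h1 h0 hc (expCircle m) ∈ W := by
      rw [toEllTwo_expCircle]
      exact W.smul_mem _ h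
    have he' := hinv (boost α) _ he
    rw [hU] at he'
    refine hmem he' (m := n) ?_
    rw [toEllTwo_apply]
    exact mul_ne_zero (sqrt_weight_ne_zero h1 h0 hc n) hα

end

/-! ### Analyticity in the parameter -/

theorem differentiableOn_weightC (n : ℕ) :
    DifferentiableOn ℂ (fun z => weightC z n) {z | -1 < z.re ∧ z.re < 0} := by
  refine DifferentiableOn.fun_finsetProd fun j _ => ?_
  refine DifferentiableOn.div (by fun_prop) (by fun_prop) fun z hz h => ?_
  have := congrArg Complex.re h
  have hj : (0 : ℝ) ≤ j := j.cast_nonneg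
  simp at this
  linarith [hz.2]

theorem isOpen_strip : IsOpen {z : ℂ | -1 < z.re ∧ z.re < 0} :=
  (isOpen_lt continuous_const Complex.continuous_re).inter
    (isOpen_lt Complex.continuous_re continuous_const)

theorem differentiableOn_tsum_weightC (f₁ f₂ : SmoothCircle) :
    DifferentiableOn ℂ (fun z => ∑' m : ℤ,
      weightC z m.natAbs * conj (fourierC f₁ m) * fourierC f₂ m)
      {z | -1 < z.re ∧ z.re < 0} := by
  intro z₀ hz₀
  have hne {z : ℂ} (hz : z.re < 0) : z ≠ 0 := by rintro rfl; simp at hz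
  obtain ⟨B, hB⟩ := exists_gt (‖(1 + z₀) / z₀‖)
  set U : Set ℂ := {z | -1 < z.re ∧ z.re < 0} ∩ {z | ‖1 + z‖ < B * ‖z‖} with hU
  have hUo : IsOpen U := isOpen_strip.inter (isOpen_lt (by fun_prop) (by fun_prop))
  have hz₀U : z₀ ∈ U := by
    refine ⟨hz₀, ?_⟩
    rw [norm_div, div_lt_iff₀ (norm_pos_iff.2 (hne hz₀.2))] at hB
    exact hB
  obtain ⟨D, hD⟩ := exists_norm_fourierC_le_div f₁
  have hs := (summable_norm_fourierC f₂).mul_left ((1 + B) * D)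
  have hd : DifferentiableOn ℂ (fun z => ∑' m : ℤ,
      weightC z m.natAbs * conj (fourierC f₁ m) * fourierC f₂ m) U := by
    refine Complex.differentiableOn_tsum_of_summable_norm hs (fun m => ?_) hUo fun m z hz => ?_
    · exact (((differentiableOn_weightC _).mono inter_subset_left).mul_const _).mul_const _
    · have hp : 0 < 1 + (m : ℝ) ^ 2 := by positivity
      have hb : ‖(1 + z) / z‖ ≤ B := by
        rw [norm_div, div_le_iff₀ (norm_pos_iff.2 (hne hz.1.2))]
        exact hz.2.le
      have hw := (norm_weightC_le hz.1.1 hz.1.2 m).trans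
        (mul_le_mul_of_nonneg_right (by linarith : 1 + ‖(1 + z) / z‖ ≤ 1 + B) hp.le)
      rw [norm_mul, norm_mul, RCLike.norm_conj]
      refine mul_le_mul_of_nonneg_right ?_ (norm_nonneg _)
      calc _ ≤ ((1 + B) * (1 + (m : ℝ) ^ 2)) * (D * (1 + (m : ℝ) ^ 2)⁻¹) :=
            mul_le_mul hw (hD m) (norm_nonneg _) ((norm_nonneg _).trans hw)
        _ = _ := by field_simp
  exact (hd.differentiableAt (hUo.mem_nhds hz₀U)).differentiableWithinAt

theorem analyticOnNhd_diagForm (c₀ : ℝ) (f₁ f₂ : SmoothCircle) :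
    AnalyticOnNhd ℝ (fun s : ℝ => diagForm c₀ s f₁ f₂) (Ioo (-1) 0) := by
  let Z : ℂ → ℂ := fun z => ((c₀ : ℂ) * 2 ^ (-z - 1) / (Real.sqrt Real.pi : ℂ) *
    (Complex.Gamma (-z))⁻¹) *
    ∑' m : ℤ, weightC z m.natAbs * conj (fourierC f₁ m) * fourierC f₂ m
  have hZ : DifferentiableOn ℂ Z {z | -1 < z.re ∧ z.re < 0} := by
    refine DifferentiableOn.mul (Differentiable.differentiableOn ?_)
      (differentiableOn_tsum_weightC f₁ f₂)
    refine Differentiable.mul (Differentiable.div_const (Differentiable.const_mul ?_ _) _)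
      (Complex.differentiable_one_div_Gamma.comp differentiable_neg)
    intro z
    exact DifferentiableAt.const_cpow (by fun_prop) (Or.inl two_ne_zero)
  intro s hs
  have hZs : AnalyticAt ℂ Z (s : ℂ) := hZ.analyticAt (isOpen_strip.mem_nhds ⟨hs.1, hs.2⟩)
  have hR : AnalyticAt ℝ (fun s : ℝ => Z s) s :=
    AnalyticAt.comp (f := fun s : ℝ => (s : ℂ)) (hZs.restrictScalars (𝕜 := ℝ))
      (Complex.ofRealCLM.analyticAt s)
  refine hR.congr ?_
  filter_upwards [isOpen_Ioo.mem_nhds hs] with t ht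
  rw [diagForm_eq (ne_int_of_mem_strip ht.1 ht.2), weightForm, formConst]
  simp only [Z, ofReal_weight]
  congr 1
  push_cast
  rw [← Complex.Gamma_ofReal, Complex.ofReal_cpow zero_le_two]
  push_cast
  rw [← div_eq_mul_inv, div_div]

/-! ### The integral form -/

/-- The beta integral in trigonometric form. -/
theorem integral_sin_rpow {s : ℝ} (hs : -1 / 2 < s) :
    IntegrableOn (fun x => Real.sin x ^ (2 * s)) (Ioo 0 Real.pi) ∧
      ∫ x in Ioo 0 Real.pi, Real.sin x ^ (2 * s) =
        Real.sqrt Real.pi * Real.Gamma (s + 1 / 2) / Real.Gamma (s + 1) := by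
  -- substitute `t = (1 - cos x) / 2` in the integral of `(t (1 - t)) ^ (s - 1/2)`
  let a : ℝ := s + 1 / 2
  have ha : 0 < a := by simp only [a]; linarith
  let g : ℝ → ℝ := fun t => t ^ (a - 1) * (1 - t) ^ (a - 1)
  have hcast {t : ℝ} (ht : t ∈ Ioo (0 : ℝ) 1) :
      (t : ℂ) ^ ((a : ℂ) - 1) * (1 - (t : ℂ)) ^ ((a : ℂ) - 1) = (g t : ℂ) := by
    have h1 : (0 : ℝ) ≤ 1 - t := by linarith [ht.2]
    simp only [g]
    rw [Complex.ofReal_mul, Complex.ofReal_cpow ht.1.le, Complex.ofReal_cpow h1]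
    push_cast
    rfl
  have hgc : IntegrableOn (fun t => (g t : ℂ)) (Ioo 0 1) := by
    have h := Complex.betaIntegral_convergent (u := a) (v := a) (by simpa using ha)
      (by simpa using ha)
    rw [intervalIntegrable_iff_integrableOn_Ioo_of_le zero_le_one] at h
    exact h.congr_fun (fun t ht => hcast ht) measurableSet_Ioo
  have hgi : IntegrableOn g (Ioo 0 1) := by simpa [IntegrableOn] using hgc.re
  have hgv : ∫ t in Ioo 0 1, g t = Real.Gamma a * Real.Gamma a / Real.Gamma (2 * a) := by
    have h := Complex.betaIntegral_eq_Gamma_mul_div a a (by simpa using ha) (by simpa using ha)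
    rw [Complex.betaIntegral, intervalIntegral.integral_of_le zero_le_one,
      integral_Ioc_eq_integral_Ioo, setIntegral_congr_fun measurableSet_Ioo (fun t ht => hcast ht),
      integral_complex_ofReal, ← Complex.ofReal_add, Complex.Gamma_ofReal,
      Complex.Gamma_ofReal] at h
    rw [two_mul]
    exact_mod_cast h
  let f : ℝ → ℝ := fun x => (1 - Real.cos x) / 2
  have hf' (x : ℝ) (_ : x ∈ Ioo 0 Real.pi) :
      HasDerivWithinAt f (Real.sin x / 2) (Ioo 0 Real.pi) x := by
    have := ((Real.hasDerivAt_cos x).const_sub 1).div_const 2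
    simpa [f] using this.hasDerivWithinAt
  have hinj : InjOn f (Ioo 0 Real.pi) := by
    intro x hx y hy hxy
    refine Real.injOn_cos ⟨hx.1.le, hx.2.le⟩ ⟨hy.1.le, hy.2.le⟩ ?_
    simp only [f] at hxy
    linarith
  have himg : f '' Ioo 0 Real.pi = Ioo 0 1 := by
    ext t
    constructor
    · rintro ⟨x, hx, rfl⟩
      have h1 := Real.cos_lt_cos_of_nonneg_of_le_pi le_rfl hx.2.le hx.1
      have h2 := Real.cos_lt_cos_of_nonneg_of_le_pi hx.1.le le_rfl hx.2
      rw [Real.cos_zero] at h1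
      rw [Real.cos_pi] at h2
      constructor <;> simp only [f] <;> linarith
    · intro ht
      refine ⟨Real.arccos (1 - 2 * t), ⟨Real.arccos_pos.2 (by linarith [ht.1]), ?_⟩, ?_⟩
      · refine lt_of_le_of_ne (Real.arccos_le_pi _) fun h => ?_
        rw [Real.arccos_eq_pi] at h
        linarith [ht.2]
      · simp only [f]
        rw [Real.cos_arccos (by linarith [ht.2]) (by linarith [ht.1])]
        ring
  have hcomp {x : ℝ} (hx : x ∈ Ioo 0 Real.pi) :
      |Real.sin x / 2| • g (f x) = 2 ^ (-(2 * s)) * Real.sin x ^ (2 * s) := by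
    have hsin := Real.sin_pos_of_pos_of_lt_pi hx.1 hx.2
    have hfx : f x ∈ Ioo (0 : ℝ) 1 := himg ▸ mem_image_of_mem f hx
    have hprod : f x * (1 - f x) = (Real.sin x / 2) ^ 2 := by
      simp only [f]
      linear_combination (-1 / 4 : ℝ) * Real.sin_sq_add_cos_sq x
    have hhalf : 0 < Real.sin x / 2 := by positivity
    simp only [g, a]
    rw [← Real.mul_rpow hfx.1.le (by linarith [hfx.2]), hprod, abs_of_pos hhalf, smul_eq_mul,
      ← Real.rpow_natCast, ← Real.rpow_mul hhalf.le]
    nth_rewrite 1 [← Real.rpow_one (Real.sin x / 2)]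
    rw [← Real.rpow_add hhalf, Real.div_rpow hsin.le zero_le_two, Real.rpow_neg zero_le_two,
      show 1 + ((2 : ℕ) : ℝ) * (s + 1 / 2 - 1) = 2 * s by push_cast; ring]
    ring
  have h2 : (2 : ℝ) ^ (-(2 * s)) ≠ 0 := (Real.rpow_pos_of_pos two_pos _).ne'
  constructor
  · have h := (integrableOn_image_iff_integrableOn_abs_deriv_smul measurableSet_Ioo hf' hinj g).1
      (himg ▸ hgi)
    have h' := h.congr_fun (fun x hx => hcomp hx) measurableSet_Ioo
    have h'' := h'.const_mul ((2 : ℝ) ^ (-(2 * s)))⁻¹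
    refine h''.congr (Eventually.of_forall fun x => ?_)
    simp only
    rw [inv_mul_cancel_left₀ h2]
  · have h := integral_image_eq_integral_abs_deriv_smul measurableSet_Ioo hf' hinj g
    rw [himg, hgv, setIntegral_congr_fun measurableSet_Ioo (fun x hx => hcomp hx),
      integral_const_mul] at h
    have hdup := Real.Gamma_mul_Gamma_add_half a
    have hG1 := Real.Gamma_pos_of_pos (s := 2 * a) (by linarith)
    have e1 : a + 1 / 2 = s + 1 := by simp only [a]; ring
    have e2 : 1 - 2 * a = -(2 * s) := by simp only [a]; ring
    rw [e1, e2] at hdup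
    have hG2 := Real.Gamma_pos_of_pos (s := s + 1) (by linarith)
    rw [eq_div_iff hG2.ne']
    apply mul_left_cancel₀ h2
    rw [← mul_assoc, ← h, show s + 1 / 2 = a from rfl]
    field_simp
    linear_combination hdup

/-- The kernel `(1 - cos x)^s`, `s = -σ - 1`. For `s < 0` its values at the singularities `x ∈ 2πℤ`
are junk; these points form a null set. -/
noncomputable def kernel (σ : ℝ) (x : ℝ) : ℝ := (1 - Real.cos x) ^ (-σ - 1)

theorem kernel_periodic (σ : ℝ) : Function.Periodic (kernel σ) (2 * Real.pi) := fun x => by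
  simp [kernel]

theorem measurable_kernel (σ : ℝ) : Measurable (kernel σ) := by
  unfold kernel
  fun_prop

theorem kernel_nonneg (σ x : ℝ) : 0 ≤ kernel σ x :=
  Real.rpow_nonneg (by linarith [Real.cos_le_one x]) _

theorem kernel_two_mul (σ : ℝ) {y : ℝ} (hy : y ∈ Icc 0 Real.pi) :
    kernel σ (2 * y) = 2 ^ (-σ - 1) * Real.sin y ^ (2 * (-σ - 1)) := by
  have hs := Real.sin_nonneg_of_mem_Icc hy
  rw [kernel, show 1 - Real.cos (2 * y) = 2 * Real.sin y ^ 2 by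
    rw [Real.cos_two_mul]; linear_combination (-2 : ℝ) * Real.sin_sq_add_cos_sq y,
    Real.mul_rpow zero_le_two (by positivity), ← Real.rpow_natCast, ← Real.rpow_mul hs]
  push_cast
  rfl

theorem intervalIntegrable_sin_rpow {s : ℝ} (hs : -1 / 2 < s) :
    IntervalIntegrable (fun x => Real.sin x ^ (2 * s)) volume 0 Real.pi := by
  rw [intervalIntegrable_iff_integrableOn_Ioo_of_le Real.pi_pos.le]
  exact (integral_sin_rpow hs).1

theorem intervalIntegrable_kernel {σ : ℝ} (h : σ < -1 / 2) (a b : ℝ) :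
    IntervalIntegrable (kernel σ) volume a b := by
  refine (kernel_periodic σ).intervalIntegrable₀ (by positivity) ?_ a b
  have h1 := (intervalIntegrable_sin_rpow (s := -σ - 1) (by linarith)).const_mul (2 ^ (-σ - 1))
  have h2 : IntervalIntegrable (fun y => kernel σ (2 * y)) volume 0 Real.pi := by
    refine h1.congr fun y hy => ?_
    rw [uIoc_of_le Real.pi_pos.le] at hy
    exact (kernel_two_mul σ ⟨hy.1.le, hy.2⟩).symm
  have h3 := h2.comp_mul_left (c := 2⁻¹)
  have e : (fun x => kernel σ (2 * (2⁻¹ * x))) = kernel σ := by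
    funext x
    rw [mul_inv_cancel_left₀ two_ne_zero]
  rw [e, zero_div, div_inv_eq_mul, mul_comm] at h3
  exact h3

/-- The Fourier coefficients of the kernel, without the factor `1 / 2π`. -/
noncomputable def kernelCoeff (σ : ℝ) (m : ℤ) : ℂ :=
  ∫ x in (0 : ℝ)..(2 * Real.pi), (kernel σ x : ℂ) * Complex.exp (-(Complex.I * m * x))

theorem kernelCoeff_eq (σ : ℝ) (m : ℤ) : kernelCoeff σ m =
    2 * ((2 ^ (-σ - 1) : ℝ) : ℂ) * ∫ y in (0 : ℝ)..Real.pi,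
      ((Real.sin y ^ (2 * (-σ - 1)) : ℝ) : ℂ) * Complex.exp (-(Complex.I * (2 * m) * y)) := by
  have h := intervalIntegral.smul_integral_comp_mul_left (E := ℂ) (a := 0) (b := Real.pi)
    (fun x : ℝ => (kernel σ x : ℂ) * Complex.exp (-(Complex.I * m * x))) 2
  rw [mul_zero] at h
  rw [kernelCoeff, ← h, Complex.real_smul, mul_assoc, Complex.ofReal_ofNat]
  congr 1
  rw [← intervalIntegral.integral_const_mul]
  refine intervalIntegral.integral_congr (μ := volume) (E := ℂ) fun y hy => ?_
  rw [uIcc_of_le Real.pi_pos.le] at hy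
  rw [kernel_two_mul σ hy]
  push_cast
  ring_nf

/-- Integration by parts gives for the Fourier coefficients of the kernel the recurrence of the
weights. -/
theorem kernelCoeff_succ {σ : ℝ} (h : σ < -1 / 2) (m : ℤ) :
    kernelCoeff σ (m + 1) * (m - σ) = kernelCoeff σ m * (m + 1 + σ) := by
  set s : ℝ := -σ - 1 with hs
  have hs2 : -1 / 2 < s := by linarith
  let F : ℝ → ℂ := fun y => ((Real.sin y ^ (2 * s + 1) : ℝ) : ℂ) *
    Complex.exp (-(Complex.I * (2 * m + 1) * y))
  let E : ℤ → ℝ → ℂ := fun m y => ((Real.sin y ^ (2 * s) : ℝ) : ℂ) *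
    Complex.exp (-(Complex.I * (2 * m) * y))
  have hE (m : ℤ) : IntervalIntegrable (E m) volume 0 Real.pi :=
    IntervalIntegrable.mul_continuousOn ⟨(intervalIntegrable_sin_rpow hs2).1.ofReal,
      (intervalIntegrable_sin_rpow hs2).2.ofReal⟩ (by fun_prop)
  have hcont : ContinuousOn F (Icc 0 Real.pi) := by
    refine Continuous.continuousOn (Continuous.mul ?_ (by fun_prop))
    exact Complex.continuous_ofReal.comp
      (Real.continuous_sin.rpow_const fun _ => Or.inr (by linarith))
  have hder (y : ℝ) (hy : y ∈ Ioo 0 Real.pi) :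
      HasDerivAt F ((s - m) * E m y + (s + m + 1) * E (m + 1) y) y := by
    have hsin := Real.sin_pos_of_pos_of_lt_pi hy.1 hy.2
    have h1 : HasDerivAt (fun y => ((Real.sin y ^ (2 * s + 1) : ℝ) : ℂ))
        ((Real.cos y * (2 * s + 1) * Real.sin y ^ (2 * s) : ℝ) : ℂ) y := by
      have := ((Real.hasDerivAt_sin y).rpow_const (p := 2 * s + 1) (Or.inl hsin.ne')).ofReal_comp
      rwa [add_sub_cancel_right] at this
    have h2 : HasDerivAt (fun y : ℝ => Complex.exp (-(Complex.I * (2 * m + 1) * y)))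
        (Complex.exp (-(Complex.I * (2 * m + 1) * y)) * -(Complex.I * (2 * m + 1))) y := by
      have h0 : HasDerivAt (fun φ : ℝ => -(Complex.I * (2 * m + 1) * (φ : ℂ)))
          (-(Complex.I * (2 * m + 1))) y := by
        simpa using ((Complex.ofRealCLM.hasDerivAt (x := y)).const_mul
          (Complex.I * (2 * (m : ℂ) + 1))).fun_neg
      exact h0.cexp
    refine (h1.mul h2).congr_deriv ?_
    have e1 : Complex.exp (-(Complex.I * (2 * m) * y)) =
        Complex.exp (-(Complex.I * (2 * m + 1) * y)) * Complex.exp (y * Complex.I) := by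
      rw [← Complex.exp_add]; ring_nf
    have e2 : Complex.exp (-(Complex.I * (2 * (m + 1 : ℤ)) * y)) =
        Complex.exp (-(Complex.I * (2 * m + 1) * y)) * Complex.exp (-y * Complex.I) := by
      rw [← Complex.exp_add]; push_cast; ring_nf
    simp only [E]
    rw [e1, e2, Real.rpow_add_one hsin.ne']
    push_cast
    rw [Complex.cos, Complex.sin]
    linear_combination (-(Complex.exp (-(Complex.I * (2 * m + 1) * y))) * (2 * m + 1) *
      ((Real.sin y ^ (2 * s) : ℝ) : ℂ) * (Complex.exp (-y * Complex.I) -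
      Complex.exp (y * Complex.I)) / 2) * Complex.I_mul_I
  have hint := intervalIntegral.integral_eq_sub_of_hasDerivAt_of_le Real.pi_pos.le hcont hder
    (((hE m).const_mul _).add ((hE (m + 1)).const_mul _))
  have h0 : (0 : ℝ) ^ (2 * s + 1) = 0 := Real.zero_rpow (by linarith)
  rw [intervalIntegral.integral_add ((hE m).const_mul _) ((hE (m + 1)).const_mul _),
    intervalIntegral.integral_const_mul, intervalIntegral.integral_const_mul] at hint
  simp only [F, Real.sin_pi, Real.sin_zero, h0, Complex.ofReal_zero, zero_mul, sub_self] at hint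
  have hsC : (s : ℂ) = -σ - 1 := by rw [hs]; push_cast; rfl
  rw [hsC] at hint
  rw [kernelCoeff_eq, kernelCoeff_eq, ← hs]
  simp only [E] at hint
  linear_combination (2 * ((2 ^ s : ℝ) : ℂ)) * hint

theorem kernelCoeff_zero {σ : ℝ} (h : σ < -1 / 2) : kernelCoeff σ 0 =
    ((2 ^ (-σ) * Real.sqrt Real.pi * Real.Gamma (-σ - 1 / 2) / Real.Gamma (-σ) : ℝ) : ℂ) := by
  have hv := (integral_sin_rpow (s := -σ - 1) (by linarith)).2
  rw [kernelCoeff_eq]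
  simp only [Int.cast_zero, mul_zero, zero_mul, neg_zero, Complex.exp_zero, mul_one]
  rw [intervalIntegral.integral_ofReal, intervalIntegral.integral_of_le Real.pi_pos.le,
    integral_Ioc_eq_integral_Ioo, hv, show -σ - 1 + 1 / 2 = -σ - 1 / 2 by ring, sub_add_cancel]
  have h2 : (2 : ℝ) ^ (-σ) = 2 * 2 ^ (-σ - 1) := by
    rw [Real.rpow_sub_one two_ne_zero]; ring
  rw [h2]
  push_cast
  ring

theorem kernelCoeff_eq_mul_weight {σ : ℝ} (h1 : -1 < σ) (h : σ < -1 / 2) (m : ℤ) :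
    kernelCoeff σ m = kernelCoeff σ 0 * weight σ m :=
  eq_mul_weight (ne_int_of_mem_strip h1 (by linarith)) (kernelCoeff_succ h) m

theorem norm_kernelCoeff_le {σ : ℝ} (h : σ < -1 / 2) (m : ℤ) :
    ‖kernelCoeff σ m‖ ≤ ∫ x in (0 : ℝ)..(2 * Real.pi), kernel σ x := by
  refine intervalIntegral.norm_integral_le_of_norm_le Real.two_pi_pos.le
    (Eventually.of_forall fun x _ => ?_) (intervalIntegrable_kernel h _ _)
  rw [norm_mul, norm_exp_neg_I_mul_int_mul, mul_one, Complex.norm_real,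
    Real.norm_of_nonneg (kernel_nonneg σ x)]

theorem intervalIntegrable_kernel_sub {σ : ℝ} (h : σ < -1 / 2) (φ a b : ℝ) :
    IntervalIntegrable (fun x => kernel σ (φ - x)) volume a b := by
  have := (intervalIntegrable_kernel h (φ - a) (φ - b)).comp_sub_left φ
  simpa using this

theorem integral_kernel_mul_exp (σ : ℝ) (m : ℤ) (φ : ℝ) :
    ∫ x in (0 : ℝ)..(2 * Real.pi), (kernel σ (φ - x) : ℂ) * Complex.exp (Complex.I * m * x) =
      kernelCoeff σ m * Complex.exp (Complex.I * m * φ) := by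
  let k : ℝ → ℂ := fun x => (kernel σ x : ℂ) * Complex.exp (-(Complex.I * m * x))
  have hper : Function.Periodic k (2 * Real.pi) := fun x => by
    have := exp_I_mul_int_mul_add_two_pi (-m) x
    simp only [k, kernel_periodic σ x]
    congr 1
    push_cast at this ⊢
    simpa using this
  have e (x : ℝ) : (kernel σ (φ - x) : ℂ) * Complex.exp (Complex.I * m * x) =
      Complex.exp (Complex.I * m * φ) * k (φ - x) := by
    simp only [k]
    rw [mul_left_comm, ← Complex.exp_add]
    congr 2
    push_cast
    ring
  simp only [e]
  rw [intervalIntegral.integral_const_mul, intervalIntegral.integral_comp_sub_left]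
  have := hper.intervalIntegral_add_eq (φ - 2 * Real.pi) 0
  rw [zero_add, sub_add_cancel] at this
  rw [sub_zero, this, mul_comm]
  rfl

theorem hasSum_integral_kernel {σ : ℝ} (h : σ < -1 / 2) (f : SmoothCircle) (φ : ℝ) :
    HasSum (fun m : ℤ => fourierC f m * (kernelCoeff σ m * Complex.exp (Complex.I * m * φ)))
      (∫ x in (0 : ℝ)..(2 * Real.pi), (kernel σ (φ - x) : ℂ) * (f : ℝ → ℂ) x) := by
  have hk := intervalIntegrable_kernel_sub h φ 0 (2 * Real.pi)
  have hmeas : Measurable fun x => (kernel σ (φ - x) : ℂ) :=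
    Complex.measurable_ofReal.comp ((measurable_kernel σ).comp (measurable_const.sub measurable_id))
  have hs := intervalIntegral.hasSum_integral_of_dominated_convergence (μ := volume) (a := 0)
    (b := 2 * Real.pi)
    (F := fun (m : ℤ) (x : ℝ) => fourierC f m *
      ((kernel σ (φ - x) : ℂ) * Complex.exp (Complex.I * m * x)))
    (f := fun x => (kernel σ (φ - x) : ℂ) * (f : ℝ → ℂ) x)
    (fun m x => ‖fourierC f m‖ * kernel σ (φ - x))
    (fun m => (measurable_const.mul (hmeas.mul
      (by fun_prop : Continuous fun x : ℝ =>
        Complex.exp (Complex.I * m * x)).measurable)).aestronglyMeasurable)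
    (fun m => Eventually.of_forall fun x _ => by
      rw [norm_mul, norm_mul, norm_exp_I_mul_int_mul, mul_one, Complex.norm_real,
        Real.norm_of_nonneg (kernel_nonneg σ _)])
    (Eventually.of_forall fun x _ => (summable_norm_fourierC f).mul_right _)
    (by simp only [tsum_mul_right]; exact hk.const_mul _)
    (Eventually.of_forall fun x _ => by
      refine (congrArg (fun F => HasSum F _) (funext fun m => ?_)).mpr
        ((hasSum_fourierC f x).mul_left (kernel σ (φ - x) : ℂ))
      ring)
  simpa only [intervalIntegral.integral_const_mul, integral_kernel_mul_exp] using hs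

theorem integral_conj_mul_exp (f : SmoothCircle) (m : ℤ) :
    ∫ φ in (0 : ℝ)..(2 * Real.pi), conj ((f : ℝ → ℂ) φ) * Complex.exp (Complex.I * m * φ) =
      2 * Real.pi * conj (fourierC f m) := by
  have hpi : (Real.pi : ℂ) ≠ 0 := by exact_mod_cast Real.pi_ne_zero
  have e (φ : ℝ) : conj ((f : ℝ → ℂ) φ) * Complex.exp (Complex.I * m * φ) =
      conj ((f : ℝ → ℂ) φ * Complex.exp (-(Complex.I * m * φ))) := by
    rw [map_mul, ← Complex.exp_conj]
    simp
  simp only [e]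
  rw [fourierC, intervalIntegral.integral_of_le Real.two_pi_pos.le,
    intervalIntegral.integral_of_le Real.two_pi_pos.le, integral_conj, map_mul]
  simp only [map_div₀, map_one, map_mul, map_ofNat, Complex.conj_ofReal]
  field_simp

theorem integral_kernelIntegrand {σ : ℝ} (h1 : -1 < σ) (h : σ < -1 / 2) (f₁ f₂ : SmoothCircle) :
    ∫ φ₁ in (0 : ℝ)..(2 * Real.pi), ∫ φ₂ in (0 : ℝ)..(2 * Real.pi), kernelIntegrand σ f₁ f₂ φ₁ φ₂ =
      2 * Real.pi * kernelCoeff σ 0 * weightForm σ f₁ f₂ := by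
  obtain ⟨C, hC⟩ := exists_bound_circle f₁
  set κ := ∫ x in (0 : ℝ)..(2 * Real.pi), kernel σ x
  have hinner (φ : ℝ) : ∫ x in (0 : ℝ)..(2 * Real.pi), kernelIntegrand σ f₁ f₂ φ x =
      conj ((f₁ : ℝ → ℂ) φ) *
        ∫ x in (0 : ℝ)..(2 * Real.pi), (kernel σ (φ - x) : ℂ) * (f₂ : ℝ → ℂ) x := by
    rw [← intervalIntegral.integral_const_mul]
    refine intervalIntegral.integral_congr fun x _ => ?_
    simp only [kernelIntegrand, kernel]
    ring
  have hsum : Summable fun m => ‖fourierC f₂ m‖ * κ * C :=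
    ((summable_norm_fourierC f₂).mul_right κ).mul_right C
  have hc1 := continuous_circle f₁
  have hs := intervalIntegral.hasSum_integral_of_dominated_convergence (μ := volume) (a := 0)
    (b := 2 * Real.pi)
    (F := fun (m : ℤ) (φ : ℝ) => fourierC f₂ m * kernelCoeff σ m *
      (conj ((f₁ : ℝ → ℂ) φ) * Complex.exp (Complex.I * m * φ)))
    (f := fun φ => conj ((f₁ : ℝ → ℂ) φ) *
        ∫ x in (0 : ℝ)..(2 * Real.pi), (kernel σ (φ - x) : ℂ) * (f₂ : ℝ → ℂ) x)
    (fun m _ => ‖fourierC f₂ m‖ * κ * C)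
    (fun m => Continuous.aestronglyMeasurable (by
      have : Continuous fun φ => conj ((f₁ : ℝ → ℂ) φ) := Complex.continuous_conj.comp hc1
      fun_prop))
    (fun m => Eventually.of_forall fun φ _ => by
      rw [norm_mul, norm_mul, norm_mul, norm_exp_I_mul_int_mul, mul_one, RCLike.norm_conj]
      exact mul_le_mul (mul_le_mul_of_nonneg_left (norm_kernelCoeff_le h m) (norm_nonneg _))
        (hC φ) (norm_nonneg _) (mul_nonneg (norm_nonneg _)
          ((norm_nonneg _).trans (norm_kernelCoeff_le h m))))
    (Eventually.of_forall fun _ _ => hsum) intervalIntegrable_const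
    (Eventually.of_forall fun φ _ => by
      refine (congrArg (fun F => HasSum F _) (funext fun m => ?_)).mpr
        ((hasSum_integral_kernel h f₂ φ).mul_left (conj ((f₁ : ℝ → ℂ) φ)))
      ring)
  simp only [hinner]
  rw [← hs.tsum_eq, weightForm, ← tsum_mul_left]
  refine tsum_congr fun m => ?_
  rw [intervalIntegral.integral_const_mul, integral_conj_mul_exp,
    kernelCoeff_eq_mul_weight h1 h]
  ring

theorem diagForm_eq_integralForm {σ : ℝ} (h1 : -1 < σ) (h : σ < -1 / 2) (c₀ : ℝ)
    (f₁ f₂ : SmoothCircle) : diagForm c₀ σ f₁ f₂ = integralForm c₀ σ f₁ f₂ := by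
  have hG1 := (Real.Gamma_pos_of_pos (s := -σ - 1 / 2) (by linarith)).ne'
  have hG2 := (Real.Gamma_pos_of_pos (s := -σ) (by linarith)).ne'
  have hpi := Real.pi_pos
  rw [diagForm_eq (ne_int_of_mem_strip h1 (by linarith)), integralForm,
    integral_kernelIntegrand h1 h, kernelCoeff_zero h, ← mul_assoc]
  congr 1
  rw [show (2 * (Real.pi : ℂ)) = ((2 * Real.pi : ℝ) : ℂ) by push_cast; rfl, ← Complex.ofReal_mul,
    ← Complex.ofReal_mul, formConst]
  congr 1
  have h2 : (2 : ℝ) ^ (-σ) = 2 * 2 ^ (-σ - 1) := by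
    rw [Real.rpow_sub_one two_ne_zero]; ring
  have hsq : Real.sqrt Real.pi * Real.sqrt Real.pi = Real.pi := Real.mul_self_sqrt hpi.le
  have hsq0 : Real.sqrt Real.pi ≠ 0 := (Real.sqrt_pos.2 hpi).ne'
  generalize Real.Gamma (-σ - 1 / 2) = g at *
  generalize Real.sqrt Real.pi = r at *
  rw [h2, ← hsq]
  field_simp
  ring

theorem integrableOn_kernelIntegrand {σ : ℝ} (h : σ < -1 / 2) (f₁ f₂ : SmoothCircle) :
    IntegrableOn (fun p : ℝ × ℝ => kernelIntegrand σ f₁ f₂ p.1 p.2)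
      (Icc 0 (2 * Real.pi) ×ˢ Icc 0 (2 * Real.pi)) := by
  set S : Set (ℝ × ℝ) := Icc 0 (2 * Real.pi) ×ˢ Icc 0 (2 * Real.pi) with hS
  have hSm : MeasurableSet S := measurableSet_Icc.prod measurableSet_Icc
  have hpi := Real.two_pi_pos
  have hone : Integrable ((Icc 0 (2 * Real.pi)).indicator fun _ : ℝ => (1 : ℝ)) :=
    (integrable_indicator_iff measurableSet_Icc).2 (integrableOn_const measure_Icc_lt_top.ne)
  have hker : Integrable ((Icc (-(2 * Real.pi)) (2 * Real.pi)).indicator (kernel σ)) := by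
    rw [integrable_indicator_iff measurableSet_Icc]
    exact (intervalIntegrable_iff_integrableOn_Icc_of_le (by linarith)).1
      (intervalIntegrable_kernel h _ _)
  have hconv := Integrable.convolution_integrand (μ := volume) (ν := volume)
    (ContinuousLinearMap.mul ℝ ℝ) hone hker
  have hK : IntegrableOn (fun p : ℝ × ℝ => (kernel σ (p.1 - p.2) : ℂ)) S := by
    have h1 : IntegrableOn (fun p : ℝ × ℝ => kernel σ (p.1 - p.2)) S := by
      refine (hconv.integrableOn (s := S)).congr_fun (fun p hp => ?_) hSm
      have hp1 := hp.1
      have hp2 := hp.2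
      simp only [ContinuousLinearMap.mul_apply']
      rw [indicator_of_mem hp2, indicator_of_mem, one_mul]
      exact ⟨by linarith [hp1.1, hp2.2], by linarith [hp1.2, hp2.1]⟩
    exact h1.ofReal
  obtain ⟨C₁, hC₁⟩ := exists_bound_circle f₁
  obtain ⟨C₂, hC₂⟩ := exists_bound_circle f₂
  have hcont : Continuous fun p : ℝ × ℝ => conj ((f₁ : ℝ → ℂ) p.1) * (f₂ : ℝ → ℂ) p.2 :=
    (Complex.continuous_conj.comp ((continuous_circle f₁).comp continuous_fst)).mul
      ((continuous_circle f₂).comp continuous_snd)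
  have := Integrable.mul_bdd (c := C₁ * C₂) hK hcont.aestronglyMeasurable
    (Eventually.of_forall fun p => by
      rw [norm_mul, RCLike.norm_conj]
      exact mul_le_mul (hC₁ _) (hC₂ _) (norm_nonneg _) ((norm_nonneg _).trans (hC₁ 0)))
  refine this.congr (Eventually.of_forall fun p => ?_)
  simp only [kernelIntegrand, kernel]
  ring

/-! ### The complementary series -/

theorem theorem1 :
    -- every group element is `r(φ₁) h(α) r(φ₂)`; `r(θ)` and `h(α)` act by the stated formulas
    ((∀ g : G, ∃ φ₁ α φ₂ : ℝ, g = rot φ₁ * boost α * rot φ₂) ∧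
      ∀ (σ : ℝ) (f : SmoothCircle) (φ : ℝ),
        (∀ θ : ℝ, (rep σ (rot θ) f : ℝ → ℂ) φ = (f : ℝ → ℂ) (φ - θ)) ∧
        (∀ α w : ℝ, w = Real.cosh α - Real.sinh α * Real.cos φ →
          0 < w ∧
          ∃ ψ : ℝ, Real.sin ψ = Real.sin φ / w ∧
            Real.cos ψ = (-Real.sinh α + Real.cosh α * Real.cos φ) / w ∧
            (rep σ (boost α) f : ℝ → ℂ) φ = ((w ^ σ : ℝ) : ℂ) * (f : ℝ → ℂ) ψ)) ∧
    -- for `-1 < σ < 0` the representation is unitary and irreducible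
    (∀ σ : ℝ, -1 < σ → σ < 0 →
      IsSmoothIrreducible (rep σ) ∧
      ∀ c₀ : ℝ, 0 < c₀ →
        (∀ f₁ f₂ : SmoothCircle,
          Summable fun m : ℤ => (Phi σ m : ℂ) * conj (fourierC f₁ m) * fourierC f₂ m) ∧
        IsScalarProduct (diagForm c₀ σ) ∧
        (∀ (g : G) (f₁ f₂ : SmoothCircle),
          diagForm c₀ σ (rep σ g f₁) (rep σ g f₂) = diagForm c₀ σ f₁ f₂) ∧
        IsIrreducibleUnitary (rep σ) (diagForm c₀ σ)) ∧
    -- the diagonal form is the integral form, regularized by analytic continuation in `σ`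
    (∀ (c₀ : ℝ) (f₁ f₂ : SmoothCircle),
      (∀ σ : ℝ, -1 < σ → σ < -1 / 2 →
        IntegrableOn (fun p : ℝ × ℝ => kernelIntegrand σ f₁ f₂ p.1 p.2)
          (Icc 0 (2 * Real.pi) ×ˢ Icc 0 (2 * Real.pi)) ∧
        diagForm c₀ σ f₁ f₂ = integralForm c₀ σ f₁ f₂) ∧
      AnalyticOnNhd ℝ (fun s : ℝ => diagForm c₀ s f₁ f₂) (Ioo (-1) 0)) ∧
    -- positivity holds exactly for `-1 < σ < 0`
    (∀ σ : ℝ, (∀ n : ℤ, σ ≠ n) → ∀ c₀ : ℝ,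
      (IsScalarProduct (diagForm c₀ σ) ↔ (-1 < σ ∧ σ < 0) ∧ 0 < c₀)) ∧
    (∀ (n : ℤ) (c : ℝ → ℝ) (B : SmoothCircle → SmoothCircle → ℂ),
      (∀ f₁ f₂ : SmoothCircle,
        Tendsto (fun s : ℝ => diagForm (c s) s f₁ f₂) (𝓝[≠] (n : ℝ)) (𝓝 (B f₁ f₂))) →
      ¬ IsScalarProduct B) := by
  refine ⟨⟨cartan_decomposition, fun σ f φ => ⟨fun θ => rep_rot_apply σ f θ φ, fun α w hw =>
    rep_boost_apply σ f φ α w hw⟩⟩, fun σ h1 h0 => ⟨isSmoothIrreducible_rep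
      (ne_int_of_mem_strip h1 h0), fun c₀ hc => ⟨summable_Phi_mul h1 h0,
        isScalarProduct_diagForm h1 h0 hc, diagForm_rep h1 h0,
        isIrreducibleUnitary_rep h1 h0 hc⟩⟩,
    fun c₀ f₁ f₂ => ⟨fun σ h1 h => ⟨integrableOn_kernelIntegrand h f₁ f₂,
      diagForm_eq_integralForm h1 h c₀ f₁ f₂⟩, analyticOnNhd_diagForm c₀ f₁ f₂⟩,
    fun σ hσ c₀ => isScalarProduct_diagForm_iff hσ c₀, not_isScalarProduct_limit⟩
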